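/- Let $d\ge 0$ be an integer. Let $\mathrm{Diff}^1_+([0,1])$ be the group of orientation-preserving $C^1$ diffeomorphisms of $[0,1]$, equipped with the distance $d_1(f,g)=\|f-g\|_\infty+\|\log Df-\log Dg\|_\infty$. Let $\rho:\mathbb Z^d\to \mathrm{Diff}^1_+([0,1])$ be a homomorphism such that, for every $v\in\mathbb Z^d$, the diffeomorphism $\rho(v)$ is of class $C^{1+bv}$, i.e. its derivative $D\rho(v)$ has finite total variation on $[0,1]$. Assume that (i) $\rho$ has no interior parabolic global fixed point: there is no $p\in(0,1)$ such that $\rho(v)(p)=p$ and $D\rho(v)(p)=1$ for all $v\in\mathbb Z^d$; (ii) the image group $\rho(\mathbb Z^d)$ is not cyclic (the trivial group counts as cyclic). Then $\rho$ embeds into a $C^1$ flow: there exist a continuous group homomorphism $t\mapsto f^t$ from $(\mathbb R,+)$ to $(\mathrm{Diff}^1_+([0,1]),d_1)$ and a group homomorphism $\tau:\mathbb Z^d\to\mathbb R$ such that $\rho(v)=f^{\tau(v)}$ for every $v\in\mathbb Z^d$. -/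

import Mathlib

open Set unitInterval

noncomputable section

namespace IntervalDiff

/-- The real-valued function on `ℝ` underlying an increasing bijection `f` of `[0,1]`. It agrees with
`f` on `[0,1]`; only its restriction to `[0,1]` is ever used. -/
def toFun (f : I ≃o I) : ℝ → ℝ := Set.IccExtend (zero_le_one' ℝ) (fun x : I => (f x : ℝ))

theorem toFun_of_mem (f : I ≃o I) {x : ℝ} (hx : x ∈ Icc (0 : ℝ) 1) : toFun f x = f ⟨x, hx⟩ :=
  Set.IccExtend_of_mem _ _ hx

theorem toFun_coe (f : I ≃o I) (x : I) : toFun f x = f x := toFun_of_mem f x.2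

theorem mapsTo_toFun (f : I ≃o I) : MapsTo (toFun f) (Icc 0 1) (Icc 0 1) := by
  intro x hx
  rw [toFun_of_mem f hx]
  exact (f ⟨x, hx⟩).2

theorem toFun_mul (f g : I ≃o I) {x : ℝ} (hx : x ∈ Icc (0 : ℝ) 1) :
    toFun (f * g) x = toFun f (toFun g x) := by
  rw [toFun_of_mem g hx, toFun_coe, toFun_of_mem _ hx]
  rfl

theorem toFun_one {x : ℝ} (hx : x ∈ Icc (0 : ℝ) 1) : toFun 1 x = x := by
  rw [toFun_of_mem _ hx]
  rfl

/-- `Diff¹₊([0,1])`: the group, under composition, of the increasing bijections `f` of `[0,1]` such that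
both `f` and `f⁻¹` are continuously differentiable on `[0,1]` (one-sidedly at the endpoints). -/
def Diff1 : Subgroup (I ≃o I) where
  carrier := {f | ContDiffOn ℝ 1 (toFun f) (Icc 0 1) ∧ ContDiffOn ℝ 1 (toFun f⁻¹) (Icc 0 1)}
  mul_mem' := by
    rintro f g ⟨hf, hf'⟩ ⟨hg, hg'⟩
    refine ⟨(hf.comp hg (mapsTo_toFun g)).congr fun x hx => toFun_mul f g hx, ?_⟩
    rw [mul_inv_rev]
    exact (hg'.comp hf' (mapsTo_toFun _)).congr fun x hx => toFun_mul _ _ hx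
  one_mem' := by
    have h : ContDiffOn ℝ 1 (toFun 1) (Icc 0 1) := contDiffOn_id.congr fun x hx => toFun_one hx
    exact ⟨h, by rwa [inv_one]⟩
  inv_mem' := by
    rintro f ⟨hf, hf'⟩
    exact ⟨hf', by rwa [inv_inv]⟩

/-- The derivative `Df` (one-sided at the endpoints). -/
def D (f : Diff1) (x : ℝ) : ℝ := derivWithin (toFun f.1) (Icc 0 1) x

theorem continuousOn_D (f : Diff1) : ContinuousOn (D f) (Icc 0 1) :=
  f.2.1.continuousOn_derivWithin (uniqueDiffOn_Icc zero_lt_one) le_rfl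

theorem hasDerivWithinAt (f : Diff1) {x : ℝ} (hx : x ∈ Icc (0 : ℝ) 1) :
    HasDerivWithinAt (toFun f.1) (D f x) (Icc 0 1) x :=
  ((f.2.1.differentiableOn one_ne_zero) x hx).hasDerivWithinAt

theorem D_ne_zero (f : Diff1) {x : ℝ} (hx : x ∈ Icc (0 : ℝ) 1) : D f x ≠ 0 := by
  have h1 := hasDerivWithinAt f hx
  have h2 := hasDerivWithinAt f⁻¹ (mapsTo_toFun f.1 hx)
  have h3 := h2.scomp x h1 (mapsTo_toFun f.1)
  have h4 : HasDerivWithinAt (toFun (f⁻¹ * f : Diff1).1) (D f x • D f⁻¹ (toFun f.1 x)) (Icc 0 1) x :=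
    h3.congr (fun y hy => toFun_mul _ _ hy) (toFun_mul _ _ hx)
  rw [inv_mul_cancel] at h4
  have h5 : HasDerivWithinAt (toFun (1 : Diff1).1) 1 (Icc 0 1) x :=
    (hasDerivWithinAt_id x _).congr (fun y hy => toFun_one hy) (toFun_one hx)
  have h6 := (uniqueDiffOn_Icc zero_lt_one x hx).eq_deriv _ h4 h5
  intro h
  simp [h] at h6

/-- An element of `Diff¹₊([0,1])` as a continuous real function on `[0,1]`. -/
def toCont (f : Diff1) : C(I, ℝ) := ⟨fun x => (f.1 x : ℝ), continuous_subtype_val.comp f.1.continuous⟩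

/-- The continuous function `log Df` on `[0,1]`. -/
def logD (f : Diff1) : C(I, ℝ) :=
  ⟨fun x => Real.log (D f x),
    ((continuousOn_D f).comp_continuous continuous_subtype_val fun x => x.2).log
      fun x => D_ne_zero f x.2⟩

theorem toCont_injective : Function.Injective toCont := by
  intro f g h
  apply Subtype.ext
  apply OrderIso.ext
  funext x
  exact Subtype.ext (DFunLike.congr_fun h x)

/-- The `C¹` distance `d₁(f,g) = ‖f - g‖_∞ + ‖log Df - log Dg‖_∞` on `Diff¹₊([0,1])`
(the norms are the sup norms of `C([0,1],ℝ)`). -/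
instance instMetricSpaceDiff1 : MetricSpace Diff1 where
  dist f g := ‖toCont f - toCont g‖ + ‖logD f - logD g‖
  dist_self f := by simp
  dist_comm f g := by rw [norm_sub_rev, norm_sub_rev (logD f)]
  dist_triangle f g h := by
    have h1 := norm_sub_le_norm_sub_add_norm_sub (toCont f) (toCont g) (toCont h)
    have h2 := norm_sub_le_norm_sub_add_norm_sub (logD f) (logD g) (logD h)
    linarith
  eq_of_dist_eq_zero := by
    intro f g h
    have h1 := norm_nonneg (toCont f - toCont g)
    have h2 := norm_nonneg (logD f - logD g)
    have h3 : ‖toCont f - toCont g‖ = 0 := by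
      change ‖toCont f - toCont g‖ + ‖logD f - logD g‖ = 0 at h
      linarith
    exact toCont_injective (sub_eq_zero.1 (norm_eq_zero.1 h3))

/-- `f` is of class `C^{1+bv}`: its derivative has finite total variation on `[0,1]`. -/
def IsC1bv (f : Diff1) : Prop := BoundedVariationOn (D f) (Icc 0 1)

/-- A `C^{1+bv}` action of `ℤ^d` on `[0,1]`, that is, a homomorphism `ℤ^d → Diff¹₊([0,1])` all of
whose values are of class `C^{1+bv}`. -/
def IsC1bvAction {d : ℕ} (ρ : Multiplicative (Fin d → ℤ) →* Diff1) : Prop := ∀ v, IsC1bv (ρ v)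

/-- `p` is a parabolic global fixed point of `ρ`: every element of the image fixes `p` and has
derivative `1` there. -/
def IsParabolicGlobalFixedPoint {d : ℕ} (ρ : Multiplicative (Fin d → ℤ) →* Diff1) (p : I) : Prop :=
  ∀ v, (ρ v).1 p = p ∧ D (ρ v) p = 1

/-- A `C¹` flow on `[0,1]`: a one-parameter group `t ↦ f^t` in `Diff¹₊([0,1])`, continuous for the
`C¹` distance. -/
def IsC1Flow (φ : Multiplicative ℝ →* Diff1) : Prop := Continuous φ

/-- `ρ` embeds into a `C¹` flow `(f^t)`: there are times `τ(v)`, depending additively on `v`, such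
that `ρ(v) = f^{τ(v)}` for every `v ∈ ℤ^d`. -/
def EmbedsIntoC1Flow {d : ℕ} (ρ : Multiplicative (Fin d → ℤ) →* Diff1) : Prop :=
  ∃ φ : Multiplicative ℝ →* Diff1, IsC1Flow φ ∧ ∃ τ : (Fin d → ℤ) →+ ℝ,
    ∀ v : Fin d → ℤ, ρ (Multiplicative.ofAdd v) = φ (Multiplicative.ofAdd (τ v))

end IntervalDiff

end

/-!
Write `G` for the image of the action. The flow is obtained by completion: there is a homomorphism
`τ` from the acting group to `ℝ`, with dense image, such that elements of small translation `τ` are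
`C¹`-close to the identity; since the distance of `Diff¹₊([0,1])` is right-invariant, the map
`τ(v) ↦ ρ(v)` is then uniformly continuous and extends to all real times
(`exists_flow_extension`).

All estimates rest on one identity. If `f` and `g` commute, then
`log Dg(x) - log Dg(fⁿx) = ∑ (log Df(fᵏx) - log Df(fᵏgx))`, and as long as `x` and `gx` lie in one
fundamental domain of `f`, the sum is bounded by the variation of `log Df` along the orbit
(`LogDerivAction.distortion`). Its consequences are as follows.

* Kopell's lemma (`LogDerivAction.eventually_fixed`): an element fixing a point that another one
  moves is the identity near it. Hence on each component of the complement of the global fixed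
  points, every element is the identity or has no fixed point, and by Hölder's theorem the order
  of each orbit comes from a homomorphism to `ℝ` (`LogDerivAction.exists_hom_lt_iff`).
* At a global fixed point `e` at the end of a component, `log D(·)(e)` is a homomorphism whose sign
  is compatible with that order, so it is proportional to the homomorphism of the component
  (`LogDerivAction.exists_ℓ_eq_mul`). Since interior global fixed points are not parabolic, the
  homomorphisms of the components on both sides are proportional, and a connectedness argument
  gives a single `τ` for all components (`LogDerivAction.exists_forall_calibrates`). The kernel of
  `τ` is that of `ρ`, so `τ` has dense image because `G` is not cyclic.
* Denjoy's argument (`LogDerivAction.exists_T_lt`): a gap in an orbit would be an interval with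
  arbitrarily many disjoint images, all between the identity and a fixed element, whose lengths are
  bounded below. Hence elements of small translation are `C⁰`-close to the identity.
* Near a global fixed point `e`, the variation of `log Df` on one side of `e` is small, so `log Dg`
  is close to its value at a global fixed point, which is proportional to `τ(g)`
  (`LogDerivAction.tendsto_ℓ_of_isFixed`). The components accumulating at an endpoint of `[0,1]`
  are covered by the same estimate. Elsewhere the identity above, with finitely many terms, carries
  this estimate along an orbit (`LogDerivAction.tendsto_ℓ`), and compactness makes it uniform.
-/

open Filter Topology

namespace IntervalDiff

/-! ### Actions with a logarithmic derivative -/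

/-- An action of an abelian group `A` on `[0,1]` by increasing bijections `T a`, together with a
function `ℓ a` playing the role of `log D(T a)`. Only the following properties of the logarithmic
derivative are retained: continuity, the chain rule, the mean value theorem, and bounded variation,
the latter expressed by a monotone function whose increments dominate those of `ℓ a`. -/
structure LogDerivAction (A : Type*) [AddCommGroup A] where
  /-- The increasing bijection by which a group element acts. -/
  T : A → I ≃o I
  /-- The logarithm of the derivative of `T a`. -/
  ℓ : A → I → ℝ
  T_add : ∀ a b x, T (a + b) x = T a (T b x)
  continuous_ℓ : ∀ a, Continuous (ℓ a)
  ℓ_add : ∀ a b x, ℓ (a + b) x = ℓ a (T b x) + ℓ b x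
  exists_mvt : ∀ a {x y : I}, x < y →
    ∃ c, x < c ∧ c < y ∧ (T a y : ℝ) - T a x = Real.exp (ℓ a c) * (y - x)
  exists_variation : ∀ a, ∃ V : I → ℝ, Monotone V ∧ ∀ x y, x ≤ y → |ℓ a y - ℓ a x| ≤ V y - V x

namespace LogDerivAction

variable {A : Type*} [AddCommGroup A] (α : LogDerivAction A)

theorem T_zero (x : I) : α.T 0 x = x := by
  apply (α.T 0).injective
  rw [← α.T_add, add_zero]

theorem T_neg_T (a : A) (x : I) : α.T (-a) (α.T a x) = x := by
  rw [← α.T_add, neg_add_cancel, α.T_zero]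

theorem T_T_neg (a : A) (x : I) : α.T a (α.T (-a) x) = x := by
  rw [← α.T_add, add_neg_cancel, α.T_zero]

theorem T_comm (a b : A) (x : I) : α.T a (α.T b x) = α.T b (α.T a x) := by
  rw [← α.T_add, add_comm, α.T_add]

theorem T_succ (a : A) (n : ℕ) (x : I) : α.T ((n + 1) • a) x = α.T (n • a) (α.T a x) := by
  rw [succ_nsmul, α.T_add]

theorem T_lt (a : A) {x y : I} : α.T a x < α.T a y ↔ x < y := (α.T a).lt_iff_lt

theorem T_le (a : A) {x y : I} : α.T a x ≤ α.T a y ↔ x ≤ y := (α.T a).le_iff_le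

theorem continuous_T (a : A) : Continuous (α.T a) := (α.T a).continuous

theorem lt_T_neg_iff (a : A) (x y : I) : y < α.T (-a) x ↔ α.T a y < x := by
  rw [← α.T_lt a, α.T_T_neg]

theorem T_neg_lt_iff (a : A) (x y : I) : α.T (-a) x < y ↔ x < α.T a y := by
  rw [← α.T_lt a, α.T_T_neg]

theorem T_neg_eq_iff (a : A) (x : I) : α.T (-a) x = x ↔ α.T a x = x := by
  rw [← (α.T a).injective.eq_iff, α.T_T_neg, eq_comm]

theorem T_nsmul_fixed {a : A} {x : I} (h : α.T a x = x) (n : ℕ) : α.T (n • a) x = x := by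
  induction n with
  | zero => rw [zero_smul, α.T_zero]
  | succ n ih => rw [α.T_succ, h, ih]

theorem ℓ_zero (x : I) : α.ℓ 0 x = 0 := by
  have := α.ℓ_add 0 0 x
  rw [add_zero, α.T_zero] at this
  linarith

theorem exists_mvt_uIcc (a : A) (x y : I) :
    ∃ c ∈ uIcc x y, (α.T a x : ℝ) - α.T a y = Real.exp (α.ℓ a c) * (x - y) := by
  rcases lt_trichotomy x y with h | rfl | h
  · obtain ⟨c, h1, h2, h3⟩ := α.exists_mvt a h
    exact ⟨c, by rw [uIcc_of_le h.le]; exact ⟨h1.le, h2.le⟩, by linarith⟩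
  · exact ⟨x, left_mem_uIcc, by simp⟩
  · obtain ⟨c, h1, h2, h3⟩ := α.exists_mvt a h
    exact ⟨c, by rw [uIcc_of_ge h.le]; exact ⟨h1.le, h2.le⟩, h3⟩

theorem exists_bound (a : A) : ∃ M, 0 < M ∧ ∀ x, |α.ℓ a x| ≤ M := by
  obtain ⟨M, hM⟩ := isCompact_univ.exists_bound_of_continuousOn (α.continuous_ℓ a).continuousOn
  exact ⟨|M| + 1, by positivity, fun x => (hM x (mem_univ x)).trans (by linarith [le_abs_self M])⟩

/-! ### Distortion along orbits -/

/-- Commutation turns the chain rule for `b` along the `a`-orbit of `x` into a comparison of the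
derivatives of `b` at the two ends of the orbit. -/
theorem ℓ_eq_add_sum (a b : A) (x : I) (n : ℕ) :
    α.ℓ b x = α.ℓ b (α.T (n • a) x) + ∑ k ∈ Finset.range n,
      (α.ℓ a (α.T (k • a) x) - α.ℓ a (α.T (k • a) (α.T b x))) := by
  induction n with
  | zero => simp [α.T_zero]
  | succ n ih =>
    have h1 := α.ℓ_add a b (α.T (n • a) x)
    rw [add_comm a b, α.ℓ_add b a, ← α.T_add a (n • a), ← succ_nsmul',
      α.T_comm b (n • a) x] at h1
    rw [Finset.sum_range_succ, ih]
    linarith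

theorem T_mem_uIcc (a : A) {x y z : I} (hz : z ∈ uIcc x y) :
    α.T a z ∈ uIcc (α.T a x) (α.T a y) := by
  rw [mem_uIcc] at hz ⊢
  simpa only [α.T_le] using hz

theorem abs_ℓ_sub_le {a : A} {V : I → ℝ} (hV : Monotone V)
    (hV' : ∀ x y, x ≤ y → |α.ℓ a y - α.ℓ a x| ≤ V y - V x) {x y z w : I}
    (hz : z ∈ uIcc x y) (hw : w ∈ uIcc x y) : |α.ℓ a z - α.ℓ a w| ≤ |V y - V x| := by
  wlog hxy : x ≤ y generalizing x y
  · rw [abs_sub_comm (V y)]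
    rw [uIcc_comm] at hz hw
    exact this hz hw (le_of_not_ge hxy)
  rw [uIcc_of_le hxy] at hz hw
  refine le_trans ?_ (le_abs_self _)
  rcases le_total z w with h | h
  · rw [abs_sub_comm]
    have := hV' z w h
    linarith [hV hw.2, hV hz.1]
  · have := hV' w z h
    linarith [hV hz.2, hV hw.1]

theorem monotone_orbit {a : A} {x : I} (h : x ≤ α.T a x) :
    Monotone fun n : ℕ => α.T (n • a) x :=
  monotone_nat_of_le_succ fun n => by rw [α.T_succ]; exact (α.T_le _).2 h

theorem antitone_orbit {a : A} {x : I} (h : α.T a x ≤ x) :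
    Antitone fun n : ℕ => α.T (n • a) x :=
  antitone_nat_of_succ_le fun n => by rw [α.T_succ]; exact (α.T_le _).2 h

theorem sum_abs_orbit (a : A) {V : I → ℝ} (hV : Monotone V) (x : I) (n : ℕ) :
    ∑ k ∈ Finset.range n, |V (α.T ((k + 1) • a) x) - V (α.T (k • a) x)|
      = |V (α.T (n • a) x) - V x| := by
  rcases le_total x (α.T a x) with h | h
  · have hm := α.monotone_orbit h
    rw [Finset.sum_congr rfl fun k _ => abs_of_nonneg (sub_nonneg.2 (hV (hm k.le_succ))),
      Finset.sum_range_sub (fun k => V (α.T (k • a) x)), zero_smul, α.T_zero, abs_of_nonneg]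
    have := hV (hm n.zero_le)
    simp only [zero_smul, α.T_zero] at this
    linarith
  · have hm := α.antitone_orbit h
    rw [Finset.sum_congr rfl fun k _ => abs_of_nonpos (sub_nonpos.2 (hV (hm k.le_succ))),
      Finset.sum_neg_distrib, Finset.sum_range_sub (fun k => V (α.T (k • a) x)), zero_smul,
      α.T_zero, abs_of_nonpos]
    have := hV (hm n.zero_le)
    simp only [zero_smul, α.T_zero] at this
    linarith

/-- If `z` and its image under `b` lie in the fundamental domain `[x, a x]` of `a`, the derivative of
`b` changes along the `a`-orbit of `z` by at most the variation of `log Da` along the orbit of `x`: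
the intervals `a^k [x, a x]` do not overlap. -/
theorem distortion {a b : A} {V : I → ℝ} (hV : Monotone V)
    (hV' : ∀ x y, x ≤ y → |α.ℓ a y - α.ℓ a x| ≤ V y - V x) {x z : I}
    (hz : z ∈ uIcc x (α.T a x)) (hbz : α.T b z ∈ uIcc x (α.T a x)) (n : ℕ) :
    |α.ℓ b z - α.ℓ b (α.T (n • a) z)| ≤ |V (α.T (n • a) x) - V x| := by
  rw [α.ℓ_eq_add_sum a b z n, add_sub_cancel_left, ← α.sum_abs_orbit a hV]
  refine (Finset.abs_sum_le_sum_abs _ _).trans (Finset.sum_le_sum fun k _ => ?_)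
  rw [α.T_succ]
  exact α.abs_ℓ_sub_le hV hV' (α.T_mem_uIcc _ hz) (α.T_mem_uIcc _ hbz)

theorem exists_tendsto_orbit (a : A) (x : I) :
    ∃ e, Tendsto (fun n : ℕ => α.T (n • a) x) atTop (𝓝 e) := by
  rcases le_total x (α.T a x) with h | h
  · exact ⟨_, tendsto_atTop_iSup (α.monotone_orbit h)⟩
  · exact ⟨_, tendsto_atTop_iInf (α.antitone_orbit h)⟩

theorem tendsto_orbit_succ {a : A} {x e : I}
    (h : Tendsto (fun n : ℕ => α.T (n • a) x) atTop (𝓝 e)) :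
    Tendsto (fun n : ℕ => α.T (n • a) (α.T a x)) atTop (𝓝 e) := by
  simp only [← α.T_succ]
  exact h.comp (tendsto_add_atTop_nat 1)

theorem T_limit {a : A} {x e : I} (h : Tendsto (fun n : ℕ => α.T (n • a) x) atTop (𝓝 e)) :
    α.T a e = e := by
  refine tendsto_nhds_unique (((α.continuous_T a).tendsto e).comp h) ?_
  convert α.tendsto_orbit_succ h using 2 with n
  exact α.T_comm _ _ _

theorem tendsto_of_mem_uIcc {u v w : ℕ → I} {e : I} (hu : Tendsto u atTop (𝓝 e))
    (hv : Tendsto v atTop (𝓝 e)) (h : ∀ n, w n ∈ uIcc (u n) (v n)) : Tendsto w atTop (𝓝 e) := by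
  refine tendsto_of_tendsto_of_tendsto_of_le_of_le (g := fun n => u n ⊓ v n)
    (h := fun n => u n ⊔ v n) ?_ ?_ (fun n => (h n).1) (fun n => (h n).2)
  · simpa using hu.inf_nhds hv
  · simpa using hu.sup_nhds hv

theorem tendsto_orbit_of_mem_uIcc {a : A} {x e z : I}
    (h : Tendsto (fun n : ℕ => α.T (n • a) x) atTop (𝓝 e)) (hz : z ∈ uIcc x (α.T a x)) :
    Tendsto (fun n : ℕ => α.T (n • a) z) atTop (𝓝 e) :=
  tendsto_of_mem_uIcc h (α.tendsto_orbit_succ h) fun _ => α.T_mem_uIcc _ hz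

theorem distortion_limit {a b : A} {V : I → ℝ} (hV : Monotone V)
    (hV' : ∀ x y, x ≤ y → |α.ℓ a y - α.ℓ a x| ≤ V y - V x) {x z e : I}
    (hz : z ∈ uIcc x (α.T a x)) (hbz : α.T b z ∈ uIcc x (α.T a x))
    (he : Tendsto (fun n : ℕ => α.T (n • a) x) atTop (𝓝 e)) {C : ℝ}
    (hC : ∀ n : ℕ, |V (α.T (n • a) x) - V x| ≤ C) : |α.ℓ b z - α.ℓ b e| ≤ C := by
  have h1 := ((α.continuous_ℓ b).tendsto e).comp (α.tendsto_orbit_of_mem_uIcc he hz)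
  exact le_of_tendsto (tendsto_const_nhds.sub h1).abs
    (Eventually.of_forall fun n => (α.distortion hV hV' hz hbz n).trans (hC n))

/-! ### Kopell's lemma -/

/-- The distortion of all powers of `b` on `[x, a x]` is bounded by the same constant, which is
incompatible with `b` having a wandering interval there. -/
theorem not_lt_of_fixed_endpoints {a b : A} {x : I} (ha : x < α.T a x) (hb : α.T b x = x) {z : I}
    (hz : z ∈ Icc x (α.T a x)) : ¬ z < α.T b z := by
  intro hlt
  obtain ⟨V, hV, hV'⟩ := α.exists_variation a
  obtain ⟨e, he⟩ := α.exists_tendsto_orbit a x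
  have hbx : ∀ m : ℕ, α.T (m • b) x = x := fun m => α.T_nsmul_fixed hb m
  have hmaps : ∀ m : ℕ, ∀ w ∈ Icc x (α.T a x), α.T (m • b) w ∈ Icc x (α.T a x) := by
    intro m w hw
    refine ⟨?_, ?_⟩
    · rw [← hbx m, α.T_le]; exact hw.1
    · have h : α.T (m • b) (α.T a x) = α.T a x := by rw [α.T_comm, hbx]
      rw [← h, α.T_le]; exact hw.2
  have hu : uIcc x (α.T a x) = Icc x (α.T a x) := uIcc_of_le ha.le
  set C := V ⊤ - V ⊥ with hC
  have hCn : ∀ n : ℕ, |V (α.T (n • a) x) - V x| ≤ C := by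
    intro n
    rw [abs_le]
    constructor <;> linarith [hV (le_top : x ≤ ⊤), hV (bot_le : ⊥ ≤ x),
      hV (le_top : α.T (n • a) x ≤ ⊤), hV (bot_le : ⊥ ≤ α.T (n • a) x)]
  -- the powers of `b` fix the orbit of `x`, which accumulates at `e`
  have hℓe : ∀ m : ℕ, α.ℓ (m • b) e = 0 := by
    intro m
    have hstep : ∀ n : ℕ, α.T (n • a) x < α.T (n • a) (α.T a x) := fun n => (α.T_lt _).2 ha
    choose c hc1 hc2 hc3 using fun n => α.exists_mvt (m • b) (hstep n)
    have h0 : ∀ n, α.ℓ (m • b) (c n) = 0 := by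
      intro n
      have h := hc3 n
      rw [α.T_comm (m • b) (n • a), α.T_comm (m • b) (n • a), α.T_comm (m • b) a, hbx] at h
      have hpos : (0 : ℝ) < (α.T (n • a) (α.T a x) : ℝ) - α.T (n • a) x :=
        sub_pos.2 (hstep n)
      have : Real.exp (α.ℓ (m • b) (c n)) = 1 := by
        have := mul_right_cancel₀ hpos.ne' ((one_mul _).trans h)
        exact this.symm
      rwa [Real.exp_eq_one_iff] at this
    have hce : Tendsto c atTop (𝓝 e) := tendsto_of_tendsto_of_tendsto_of_le_of_le he
      (α.tendsto_orbit_succ he) (fun n => (hc1 n).le) (fun n => (hc2 n).le)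
    have h2 := ((α.continuous_ℓ (m • b)).tendsto e).comp hce
    refine tendsto_nhds_unique h2 ?_
    simp only [Function.comp_def, h0]
    exact tendsto_const_nhds
  have hbound : ∀ m : ℕ, ∀ w ∈ Icc x (α.T a x), -C ≤ α.ℓ (m • b) w := by
    intro m w hw
    have := α.distortion_limit (b := m • b) hV hV' (hu ▸ hw) (hu ▸ hmaps m w hw) he hCn
    rw [hℓe, sub_zero] at this
    exact (abs_le.1 this).1
  -- the increments of the convergent sequence `b^m z` stay bounded away from zero
  obtain ⟨y, hy⟩ := α.exists_tendsto_orbit b z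
  have hy' := α.tendsto_orbit_succ hy
  have hsub : Tendsto (fun m : ℕ => ((α.T (m • b) (α.T b z) : I) : ℝ) - α.T (m • b) z) atTop
      (𝓝 0) := by
    have := (continuous_subtype_val.tendsto y |>.comp hy').sub
      (continuous_subtype_val.tendsto y |>.comp hy)
    simpa using this
  have hbz : α.T b z ∈ Icc x (α.T a x) := by simpa using hmaps 1 z hz
  have hlow : Real.exp (-C) * ((α.T b z : ℝ) - z) ≤ 0 := by
    refine ge_of_tendsto hsub (Eventually.of_forall fun m => ?_)
    obtain ⟨c, h1, h2, h3⟩ := α.exists_mvt (m • b) hlt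
    rw [h3]
    exact mul_le_mul_of_nonneg_right
      (Real.exp_le_exp.2 (hbound m c ⟨hz.1.trans h1.le, h2.le.trans hbz.2⟩))
      (sub_nonneg.2 hlt.le)
  have : (0 : ℝ) < (α.T b z : ℝ) - z := sub_pos.2 hlt
  have := mul_pos (Real.exp_pos (-C)) this
  linarith

theorem eq_of_fixed_endpoints {a b : A} {x : I} (ha : x < α.T a x) (hb : α.T b x = x) {z : I}
    (hz : z ∈ Icc x (α.T a x)) : α.T b z = z := by
  have h1 := α.not_lt_of_fixed_endpoints ha hb hz
  have h2 := α.not_lt_of_fixed_endpoints ha ((α.T_neg_eq_iff b x).2 hb) hz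
  rw [α.lt_T_neg_iff] at h2
  exact le_antisymm (not_lt.1 h1) (not_lt.1 h2)

/-- A local form of Kopell's lemma: if `b` fixes a point that a commuting element moves, then `b` is
the identity near this point. -/
theorem eventually_fixed {a b : A} {x : I} (ha : α.T a x ≠ x) (hb : α.T b x = x) :
    ∀ᶠ z in 𝓝 x, α.T b z = z := by
  wlog h : x < α.T a x generalizing a
  · refine this (a := -a) (fun h' => ha ((α.T_neg_eq_iff a x).1 h')) ?_
    rw [α.lt_T_neg_iff]
    exact lt_of_le_of_ne (not_lt.1 h) ha
  have h1 : α.T (-a) x < x := (α.T_neg_lt_iff a x x).2 h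
  have h2 : α.T b (α.T (-a) x) = α.T (-a) x := by rw [α.T_comm, hb]
  filter_upwards [Icc_mem_nhds h1 h] with z hz
  rcases le_total z x with hzx | hzx
  · refine α.eq_of_fixed_endpoints (a := a) ?_ h2 ?_
    · rwa [α.T_T_neg]
    · rw [α.T_T_neg]; exact ⟨hz.1, hzx⟩
  · exact α.eq_of_fixed_endpoints h hb ⟨hzx, hz.2⟩

/-! ### Global fixed points -/

/-- `x` is fixed by the whole group. -/
def IsFixed (x : I) : Prop := ∀ a, α.T a x = x

theorem isFixed_zero : α.IsFixed 0 := fun a => (α.T a).map_bot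

theorem isFixed_one : α.IsFixed 1 := fun a => (α.T a).map_top

theorem isClosed_isFixed : IsClosed {x | α.IsFixed x} := by
  simp only [IsFixed, ofPred_forall]
  exact isClosed_iInter fun a => isClosed_eq (α.continuous_T a) continuous_id

theorem eventually_not_isFixed {x : I} (hx : ¬α.IsFixed x) : ∀ᶠ y in 𝓝 x, ¬α.IsFixed y :=
  α.isClosed_isFixed.isOpen_compl.mem_nhds hx

theorem eventually_lt_T_iff {x : I} (hx : ¬α.IsFixed x) (b : A) :
    ∀ᶠ y in 𝓝 x, (x < α.T b x ↔ y < α.T b y) := by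
  rcases lt_trichotomy x (α.T b x) with h | h | h
  · filter_upwards [continuous_id.continuousAt.eventually_lt (α.continuous_T b).continuousAt h]
      with y hy
    exact iff_of_true h hy
  · obtain ⟨a, ha⟩ := not_forall.1 hx
    filter_upwards [α.eventually_fixed ha h.symm] with y hy
    rw [hy, ← h]
    simp
  · filter_upwards [(α.continuous_T b).continuousAt.eventually_lt continuous_id.continuousAt h]
      with y hy
    exact iff_of_false h.not_gt (not_lt.2 (le_of_lt hy))

/-- Kopell's lemma: on a connected set without global fixed points, an element of the group moves
either all points upwards, or all points downwards, or none. -/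
theorem lt_T_iff_of_isPreconnected {S : Set I} (hS : IsPreconnected S)
    (hfree : ∀ z ∈ S, ¬α.IsFixed z) {x y : I} (hx : x ∈ S) (hy : y ∈ S) (b : A) :
    x < α.T b x ↔ y < α.T b y := by
  refine hS.induction₂ (fun z w => (z < α.T b z ↔ w < α.T b w)) (fun z hz => ?_)
    (fun _ _ _ _ _ _ => Iff.trans) (fun _ _ _ _ => Iff.symm) hx hy
  exact nhdsWithin_le_nhds (α.eventually_lt_T_iff (hfree z hz) b)

theorem T_eq_iff_not (b : A) (x : I) : α.T b x = x ↔ ¬x < α.T b x ∧ ¬x < α.T (-b) x := by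
  rw [α.lt_T_neg_iff, not_lt, not_lt]
  exact le_antisymm_iff

/-- Nontrivial orbits converge to global fixed points: otherwise Kopell's lemma applies up to the
limit, which is fixed by `a`. -/
theorem isFixed_of_tendsto {a : A} {x e : I} (ha : α.T a x ≠ x)
    (he : Tendsto (fun n : ℕ => α.T (n • a) x) atTop (𝓝 e)) : α.IsFixed e := by
  by_contra hfix
  have hfree : ∀ z ∈ uIcc x e, ¬α.IsFixed z := by
    intro z hz hzf
    suffices z = e from hfix (this ▸ hzf)
    rcases le_total x e with h | h
    · rw [uIcc_of_le h] at hz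
      refine le_antisymm hz.2 (le_of_tendsto he (Eventually.of_forall fun n => ?_))
      rw [← hzf (n • a), α.T_le]
      exact hz.1
    · rw [uIcc_of_ge h] at hz
      refine le_antisymm (ge_of_tendsto he (Eventually.of_forall fun n => ?_)) hz.1
      rw [← hzf (n • a), α.T_le]
      exact hz.2
  have h := fun b => α.lt_T_iff_of_isPreconnected isPreconnected_uIcc hfree left_mem_uIcc
    right_mem_uIcc b
  apply ha
  rw [α.T_eq_iff_not, h, h, ← α.T_eq_iff_not]
  exact α.T_limit he

/-! ### Order-preserving homomorphisms to the real line -/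

/-- The archimedean property of the order in which the group moves `x`. -/
theorem exists_le_T_nsmul {a b : A} {x : I} (ha : x < α.T a x) :
    ∃ n : ℕ, α.T b x ≤ α.T (n • a) x := by
  by_contra! h
  obtain ⟨e, he⟩ := α.exists_tendsto_orbit a x
  have hfix := α.isFixed_of_tendsto ha.ne' he
  have h1 : e ≤ α.T b x := le_of_tendsto he (Eventually.of_forall fun n => (h n).le)
  have h2 : x < e := by
    refine ha.trans_le (ge_of_tendsto he (eventually_atTop.2 ⟨1, fun n hn => ?_⟩))
    simpa using α.monotone_orbit ha.le hn
  rw [← hfix b, α.T_le] at h1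
  exact h1.not_gt h2

/-- The subgroup of elements fixing `x`. -/
def stabilizer (x : I) : AddSubgroup A where
  carrier := {a | α.T a x = x}
  zero_mem' := α.T_zero x
  add_mem' := by
    intro a b ha hb
    simp only [mem_ofPred_eq] at ha hb ⊢
    rw [α.T_add, hb, ha]
  neg_mem' := by
    intro a ha
    exact (α.T_neg_eq_iff a x).2 ha

/-- The orbit map of `x`, on the quotient by its stabilizer. -/
def orbitMap (x : I) : A ⧸ α.stabilizer x → I :=
  Quotient.lift (s := QuotientAddGroup.leftRel (α.stabilizer x)) (fun a => α.T a x) (by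
    intro a b hab
    have h : α.T (-a + b) x = x := QuotientAddGroup.leftRel_apply.1 hab
    conv_lhs => rw [← h]
    rw [← α.T_add, add_neg_cancel_left])

theorem orbitMap_mk (x : I) (a : A) : α.orbitMap x (a : A ⧸ α.stabilizer x) = α.T a x := rfl

theorem orbitMap_injective (x : I) : Function.Injective (α.orbitMap x) := by
  intro p q
  induction p using QuotientAddGroup.induction_on with
  | H a =>
    induction q using QuotientAddGroup.induction_on with
    | H b =>
      intro h
      rw [α.orbitMap_mk, α.orbitMap_mk] at h
      apply QuotientAddGroup.eq.2
      change α.T (-a + b) x = x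
      rw [α.T_add, ← h, α.T_neg_T]

/-- Hölder's theorem: the order in which the group moves `x` comes from a homomorphism to the real
line. -/
theorem exists_hom_lt_iff (x : I) : ∃ μ : A →+ ℝ, ∀ a, 0 < μ a ↔ x < α.T a x := by
  let : LinearOrder (A ⧸ α.stabilizer x) := LinearOrder.lift' _ (α.orbitMap_injective x)
  have hle : ∀ p q : A ⧸ α.stabilizer x, p ≤ q ↔ α.orbitMap x p ≤ α.orbitMap x q :=
    fun _ _ => Iff.rfl
  have hlt : ∀ p q : A ⧸ α.stabilizer x, p < q ↔ α.orbitMap x p < α.orbitMap x q :=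
    fun _ _ => Iff.rfl
  have : IsOrderedAddMonoid (A ⧸ α.stabilizer x) := by
    have key : ∀ p q r : A ⧸ α.stabilizer x, p ≤ q → r + p ≤ r + q := by
      intro p q r
      induction p using QuotientAddGroup.induction_on with
      | H a =>
        induction q using QuotientAddGroup.induction_on with
        | H b =>
          induction r using QuotientAddGroup.induction_on with
          | H c =>
            rw [hle, hle, ← QuotientAddGroup.mk_add, ← QuotientAddGroup.mk_add]
            simp only [α.orbitMap_mk, α.T_add, α.T_le, imp_self]
    refine { add_le_add_left := fun p q h r => ?_ }
    rw [add_comm p, add_comm q]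
    exact key p q r h
  have : Archimedean (A ⧸ α.stabilizer x) := by
    refine ⟨fun p q => ?_⟩
    induction p using QuotientAddGroup.induction_on with
    | H a =>
      induction q using QuotientAddGroup.induction_on with
      | H b =>
        intro hb
        rw [← QuotientAddGroup.mk_zero, hlt, α.orbitMap_mk, α.orbitMap_mk, α.T_zero] at hb
        obtain ⟨n, hn⟩ := α.exists_le_T_nsmul (b := a) hb
        exact ⟨n, by rw [← QuotientAddGroup.mk_nsmul, hle]; exact hn⟩
  obtain ⟨f, hf⟩ := Archimedean.exists_orderAddMonoidHom_real_injective (A ⧸ α.stabilizer x)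
  have hmono : StrictMono f := (OrderHomClass.mono f).strictMono_of_injective hf
  refine ⟨(f : (A ⧸ α.stabilizer x) →+ ℝ).comp (QuotientAddGroup.mk' _), fun a => ?_⟩
  have h1 : (0 : ℝ) < f (a : A ⧸ α.stabilizer x) ↔ f 0 < f (a : A ⧸ α.stabilizer x) := by
    rw [map_zero]
  refine h1.trans ?_
  rw [hmono.lt_iff_lt, ← QuotientAddGroup.mk_zero, hlt, α.orbitMap_mk, α.orbitMap_mk, α.T_zero]

/-- A homomorphism to the real line is determined up to a factor by the sign of its values. -/
theorem eq_mul_of_pos_imp_nonneg {μ ν : A →+ ℝ} {a₀ : A} (h₀ : 0 < μ a₀)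
    (h : ∀ a, 0 < μ a → 0 ≤ ν a) (a : A) : ν a = ν a₀ / μ a₀ * μ a := by
  set c := ν a₀ / μ a₀ with hc
  -- if `ν b < c μ b`, a large multiple of `b`, corrected by a multiple of `a₀` to keep `μ` in
  -- `(0, μ a₀]`, has negative image under `ν`
  have hc₀ : c * μ a₀ = ν a₀ := div_mul_cancel₀ _ h₀.ne'
  have hc' : 0 ≤ c := div_nonneg (h _ h₀) h₀.le
  have key : ∀ b, ¬ν b < c * μ b := by
    intro b hb
    obtain ⟨N, hN⟩ := exists_nat_gt (ν a₀ / (c * μ b - ν b))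
    rw [div_lt_iff₀ (by linarith)] at hN
    obtain ⟨m, hm, -⟩ := existsUnique_add_zsmul_mem_Ioc h₀ (N * μ b) 0
    have e1 : μ (N • b + m • a₀) = N * μ b + m * μ a₀ := by simp
    have e2 : ν (N • b + m • a₀) = N * ν b + m * ν a₀ := by simp
    rw [zsmul_eq_mul, zero_add] at hm
    have h1 := h (N • b + m • a₀) (e1 ▸ hm.1)
    rw [e2, ← hc₀] at h1
    have h2 := mul_le_mul_of_nonneg_left hm.2 hc'
    nlinarith
  refine le_antisymm ?_ (not_lt.1 (key a))
  have := not_lt.1 (key (-a))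
  rw [map_neg, map_neg] at this
  linarith

/-! ### Derivatives at global fixed points -/

theorem eventually_forall_uIcc {P : I → Prop} {e : I} (h : ∀ᶠ z in 𝓝 e, P z) :
    ∀ᶠ y in 𝓝 e, ∀ z ∈ uIcc e y, P z := by
  obtain ⟨b, c, he, hmem, hsub⟩ := exists_Icc_mem_subset_of_mem_nhds h
  filter_upwards [hmem] with y hy z hz
  exact hsub (uIcc_subset_Icc he hy hz)

/-- Near a hyperbolic fixed point `e`, a point is moved away from `e` if `log Da(e) > 0`, and towards
`e` if `log Da(e) < 0`. -/
theorem eventually_pos_of_ℓ_ne_zero {a : A} {e : I} (he : α.T a e = e) (hℓ : α.ℓ a e ≠ 0) :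
    ∀ᶠ z in 𝓝 e, z ≠ e → 0 < ((α.T a z : ℝ) - z) * (z - e) * α.ℓ a e := by
  have h1 : ∀ᶠ c in 𝓝 e, 0 < α.ℓ a c * α.ℓ a e :=
    ((α.continuous_ℓ a).mul continuous_const).continuousAt.eventually_const_lt
      (mul_self_pos.2 hℓ)
  filter_upwards [eventually_forall_uIcc h1] with z hz hne
  obtain ⟨c, hc, heq⟩ := α.exists_mvt_uIcc a e z
  have hne' : (z : ℝ) - e ≠ 0 := sub_ne_zero.2 fun h => hne (Subtype.ext h)
  rw [he] at heq
  have h2 : (α.T a z : ℝ) - z = (Real.exp (α.ℓ a c) - 1) * (z - e) := by linarith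
  have h3 : 0 < (Real.exp (α.ℓ a c) - 1) * α.ℓ a e := by
    rcases lt_or_gt_of_ne hℓ with h | h
    · have : α.ℓ a c < 0 := by
        have := hz c hc
        by_contra! h'
        nlinarith
      exact mul_pos_of_neg_of_neg (sub_neg.2 (((Real.exp_lt_exp.2 this).trans_eq Real.exp_zero))) h
    · have : 0 < α.ℓ a c := pos_of_mul_pos_left (hz c hc) h.le
      exact mul_pos (sub_pos.2 (Real.one_lt_exp_iff.2 this)) h
  rw [h2]
  have h4 := mul_pos h3 (sq_pos_of_ne_zero hne')
  nlinarith

/-- At a global fixed point, the logarithm of the derivative is a homomorphism. -/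
def logDerivHom {e : I} (he : α.IsFixed e) : A →+ ℝ where
  toFun a := α.ℓ a e
  map_zero' := α.ℓ_zero e
  map_add' a b := by rw [α.ℓ_add, he]

theorem frequently_mem_uIcc {e y : I} (hne : y ≠ e) :
    ∃ᶠ z in 𝓝 e, z ∈ uIcc e y ∧ z ≠ e ∧ 0 < ((z : ℝ) - e) * (y - e) := by
  rcases lt_or_gt_of_ne hne with h | h
  · have : (𝓝[<] e).NeBot := nhdsLT_neBot_of_exists_lt ⟨y, h⟩
    have h1 : ∀ᶠ z in 𝓝[<] e, z ∈ uIcc e y ∧ z ≠ e ∧ 0 < ((z : ℝ) - e) * (y - e) := by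
      filter_upwards [Ico_mem_nhdsLT h] with z hz
      refine ⟨by rw [uIcc_of_ge h.le]; exact ⟨hz.1, hz.2.le⟩, hz.2.ne, ?_⟩
      exact mul_pos_of_neg_of_neg (sub_neg.2 hz.2) (sub_neg.2 h)
    exact h1.frequently.filter_mono nhdsWithin_le_nhds
  · have : (𝓝[>] e).NeBot := nhdsGT_neBot_of_exists_gt ⟨y, h⟩
    have h1 : ∀ᶠ z in 𝓝[>] e, z ∈ uIcc e y ∧ z ≠ e ∧ 0 < ((z : ℝ) - e) * (y - e) := by
      filter_upwards [Ioc_mem_nhdsGT h] with z hz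
      refine ⟨by rw [uIcc_of_le h.le]; exact ⟨hz.1.le, hz.2⟩, hz.1.ne', ?_⟩
      exact mul_pos (sub_pos.2 hz.1) (sub_pos.2 h)
    exact h1.frequently.filter_mono nhdsWithin_le_nhds

theorem isPreconnected_uIcc_sdiff (e y : I) : IsPreconnected (uIcc e y \ {e}) := by
  rcases le_total e y with h | h
  · rw [uIcc_of_le h, Icc_sdiff_left]
    exact isPreconnected_Ioc
  · rw [uIcc_of_ge h, Icc_sdiff_right]
    exact isPreconnected_Ico

theorem exists_T_gt {y : I} (hy : ¬α.IsFixed y) : ∃ a, y < α.T a y := by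
  obtain ⟨a, ha⟩ := not_forall.1 hy
  rcases lt_or_gt_of_ne ha with h | h
  · exact ⟨-a, (α.lt_T_neg_iff a y y).2 h⟩
  · exact ⟨a, h⟩

/-- If `e` is an endpoint of the component of `y` in the complement of the global fixed points, the
homomorphism `log D(·)(e)` is a multiple of the one that orders the orbit of `y`. -/
theorem exists_ℓ_eq_mul {e y : I} (he : α.IsFixed e) (hne : y ≠ e)
    (hfree : ∀ z ∈ uIcc e y, z ≠ e → ¬α.IsFixed z) {μ : A →+ ℝ}
    (hμ : ∀ a, 0 < μ a ↔ y < α.T a y) : ∃ c, ∀ a, α.ℓ a e = c * μ a := by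
  obtain ⟨a₀, ha₀⟩ := α.exists_T_gt (hfree y right_mem_uIcc hne)
  have hye : (y : ℝ) - e ≠ 0 := sub_ne_zero.2 fun h => hne (Subtype.ext h)
  have key : ∀ a, 0 < μ a → 0 ≤ ((y : ℝ) - e) * α.ℓ a e := by
    intro a ha
    by_contra! hneg
    have hℓ : α.ℓ a e ≠ 0 := by
      intro h
      simp [h] at hneg
    obtain ⟨z, ⟨hz1, hz2, hz3⟩, hz4⟩ :=
      ((frequently_mem_uIcc hne).and_eventually
        (α.eventually_pos_of_ℓ_ne_zero (he a) hℓ)).exists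
    have h1 : z < α.T a z := (α.lt_T_iff_of_isPreconnected (isPreconnected_uIcc_sdiff e y)
      (fun w hw => hfree w hw.1 hw.2) ⟨right_mem_uIcc, hne⟩ ⟨hz1, hz2⟩ a).1 ((hμ a).1 ha)
    have h2 : (0 : ℝ) < (α.T a z : ℝ) - z := sub_pos.2 h1
    have h3 : 0 < ((z : ℝ) - e) * α.ℓ a e := by
      have := hz4 hz2
      rw [mul_assoc] at this
      exact pos_of_mul_pos_right this h2.le
    nlinarith [mul_pos hz3 h3, mul_pos h3 h3, mul_pos_of_neg_of_neg hneg (neg_neg_of_pos h3),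
      sq_pos_of_ne_zero hℓ]
  let ν : A →+ ℝ := (AddMonoidHom.mulLeft ((y : ℝ) - e)).comp (α.logDerivHom he)
  have h := eq_mul_of_pos_imp_nonneg (ν := ν) ((hμ a₀).2 ha₀) key
  refine ⟨ν a₀ / μ a₀ / ((y : ℝ) - e), fun a => ?_⟩
  have h1 : ((y : ℝ) - e) * α.ℓ a e = ν a₀ / μ a₀ * μ a := h a
  rw [div_mul_eq_mul_div, ← h1, mul_div_cancel_left₀ _ hye]

/-! ### A translation homomorphism common to all components -/

/-- A homomorphism `μ` calibrates the action at `x` if, up to a nonzero factor, it orders the orbit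
of `x` when `x` is not a global fixed point, and it is `log D(·)(x)` when `x` is one. -/
def Calibrates (μ : A →+ ℝ) (x : I) : Prop :=
  ∃ s : ℝ, s ≠ 0 ∧ (α.IsFixed x → ∀ a, α.ℓ a x = s * μ a) ∧
    (¬α.IsFixed x → ∀ a, 0 < s * μ a ↔ x < α.T a x)

theorem exists_calibrates (x : I) : ∃ μ, α.Calibrates μ x := by
  by_cases hx : α.IsFixed x
  · exact ⟨α.logDerivHom hx, 1, one_ne_zero, fun _ a => (one_mul _).symm, fun h => (h hx).elim⟩
  · obtain ⟨μ, hμ⟩ := α.exists_hom_lt_iff x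
    exact ⟨μ, 1, one_ne_zero, fun h => (hx h).elim, fun _ a => by rw [one_mul, hμ]⟩

theorem eventually_calibrates_iff {x : I} (hpar : α.IsFixed x → ∃ a, α.ℓ a x ≠ 0) :
    ∀ᶠ y in 𝓝 x, ∀ μ, α.Calibrates μ x ↔ α.Calibrates μ y := by
  by_cases hx : α.IsFixed x
  · obtain ⟨a, ha⟩ := hpar hx
    filter_upwards [eventually_forall_uIcc (α.eventually_pos_of_ℓ_ne_zero (hx a) ha)] with y hy μ
    rcases eq_or_ne y x with rfl | hne
    · exact Iff.rfl
    have hfree : ∀ z ∈ uIcc x y, z ≠ x → ¬α.IsFixed z := by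
      intro z hz hzx hzf
      have := hy z hz hzx
      rw [hzf a] at this
      simp at this
    have hyf : ¬α.IsFixed y := hfree y right_mem_uIcc hne
    constructor
    · rintro ⟨s, hs, h1, -⟩
      obtain ⟨ν, hν⟩ := α.exists_hom_lt_iff y
      obtain ⟨c, hc⟩ := α.exists_ℓ_eq_mul hx hne hfree hν
      have hc0 : c ≠ 0 := by
        rintro rfl
        exact ha (by rw [hc, zero_mul])
      refine ⟨s / c, div_ne_zero hs hc0, fun h => (hyf h).elim, fun _ b => ?_⟩
      rw [← hν b, div_mul_eq_mul_div, ← h1 hx b, hc b, mul_div_cancel_left₀ _ hc0]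
    · rintro ⟨s, hs, -, h2⟩
      obtain ⟨c, hc⟩ := α.exists_ℓ_eq_mul hx hne hfree
        (μ := (AddMonoidHom.mulLeft s).comp μ) (h2 hyf)
      have hc' : ∀ b, α.ℓ b x = c * s * μ b := fun b => by rw [hc b, mul_assoc]; rfl
      refine ⟨c * s, mul_ne_zero ?_ hs, fun _ => hc', fun h => (h hx).elim⟩
      rintro rfl
      exact ha (by rw [hc', zero_mul, zero_mul])
  · filter_upwards [eventually_forall_uIcc (α.eventually_not_isFixed hx)] with y hy μ
    have hyf := hy y right_mem_uIcc
    have h := fun a => α.lt_T_iff_of_isPreconnected isPreconnected_uIcc hy left_mem_uIcc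
      right_mem_uIcc a
    simp only [Calibrates, hx, hyf, h, false_imp_iff, not_false_eq_true, true_imp_iff]

/-- Without interior parabolic global fixed points, a single homomorphism calibrates the action at
all interior points: neighbouring components are tied together by the derivatives at the hyperbolic
fixed point between them. -/
theorem exists_forall_calibrates
    (hpar : ∀ x : I, 0 < x → x < 1 → α.IsFixed x → ∃ a, α.ℓ a x ≠ 0) :
    ∃ μ, ∀ x : I, 0 < x → x < 1 → α.Calibrates μ x := by
  have hmem : (⟨1 / 2, by norm_num, by norm_num⟩ : I) ∈ Ioo (0 : I) 1 := by
    constructor <;> exact Subtype.coe_lt_coe.1 (by norm_num)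
  obtain ⟨μ, hμ⟩ := α.exists_calibrates ⟨1 / 2, by norm_num, by norm_num⟩
  refine ⟨μ, fun x h0 h1 => ?_⟩
  refine (isPreconnected_Ioo.induction₂ (fun y z => ∀ μ, α.Calibrates μ y ↔ α.Calibrates μ z)
    (fun y hy => nhdsWithin_le_nhds (α.eventually_calibrates_iff (hpar y hy.1 hy.2)))
    (fun _ _ _ _ _ _ h h' μ => (h μ).trans (h' μ)) (fun _ _ _ _ h μ => (h μ).symm)
    hmem ⟨h0, h1⟩ μ).1 hμ

/-! ### Denjoy's argument: absence of wandering intervals -/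

theorem T_le_of_le {μ : A →+ ℝ} {x : I} (hμ : ∀ a, 0 < μ a ↔ x < α.T a x) {b c : A}
    (h : μ b ≤ μ c) : α.T b x ≤ α.T c x := by
  have h1 : ¬x < α.T (b - c) x := by
    rw [← hμ, map_sub]
    linarith
  have h2 : α.T b x = α.T c (α.T (b - c) x) := by rw [← α.T_add, add_sub_cancel]
  rw [h2, α.T_le]
  exact not_lt.1 h1

theorem T_lt_of_lt {μ : A →+ ℝ} {x : I} (hμ : ∀ a, 0 < μ a ↔ x < α.T a x) {b c : A}
    (h : μ b < μ c) : α.T b x < α.T c x := by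
  have h1 : x < α.T (c - b) x := by
    rw [← hμ, map_sub]
    linarith
  have h2 : α.T c x = α.T b (α.T (c - b) x) := by rw [← α.T_add, add_sub_cancel]
  rwa [h2, α.T_lt]

theorem abs_sub_le_of_monotone {V : I → ℝ} (hV : Monotone V) (x y : I) :
    |V x - V y| ≤ V ⊤ - V ⊥ := by
  rw [abs_le]
  constructor <;> linarith [hV (le_top : x ≤ ⊤), hV (bot_le : ⊥ ≤ x), hV (le_top : y ≤ ⊤),
    hV (bot_le : ⊥ ≤ y)]

/-- The derivative of `b` is at least `1` at the left endpoint of a component on which `b` moves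
points upwards. -/
theorem ℓ_nonneg_of_antitone {a b : A} {x e : I} (ha : α.T a x < x)
    (he : Tendsto (fun n : ℕ => α.T (n • a) x) atTop (𝓝 e)) (hb : x < α.T b x) :
    0 ≤ α.ℓ b e := by
  by_contra! hneg
  have hfix := α.isFixed_of_tendsto ha.ne he
  obtain ⟨n, hn⟩ := (he.eventually (α.eventually_pos_of_ℓ_ne_zero (hfix b) hneg.ne)).exists
  have h1 : e < α.T (n • a) x := by
    have h : e ≤ α.T ((n + 1) • a) x := le_of_tendsto he (eventually_atTop.2
      ⟨n + 1, fun m hm => α.antitone_orbit ha.le hm⟩)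
    refine h.trans_lt ?_
    rwa [α.T_succ, α.T_lt]
  have h2 : α.T (n • a) x < α.T b (α.T (n • a) x) := by rwa [α.T_comm, α.T_lt]
  have h3 := hn h1.ne'
  have h4 : 0 < ((α.T b (α.T (n • a) x) : ℝ) - α.T (n • a) x) * (α.T (n • a) x - e) :=
    mul_pos (sub_pos.2 h2) (sub_pos.2 h1)
  nlinarith

/-- The derivatives of the elements between the identity and `a` are bounded below at the points of
a fundamental domain of `a`. -/
theorem exists_forall_le_ℓ {μ : A →+ ℝ} {x : I} (hμ : ∀ a, 0 < μ a ↔ x < α.T a x) {a : A}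
    (ha : 0 < μ a) :
    ∃ C, ∀ b, 0 < μ b → μ b < μ a → ∀ z ∈ Icc x (α.T a x), -C ≤ α.ℓ b z := by
  -- `[x, a x]` and its images under the elements `b` in question lie in `[x, a² x]`, a fundamental
  -- domain of `a⁻²`, whose iterates lead to the left endpoint `e`
  set x' := α.T (a + a) x with hx'
  have hcancel : α.T (-(a + a)) x' = x := α.T_neg_T _ _
  obtain ⟨V, hV, hV'⟩ := α.exists_variation (-(a + a))
  obtain ⟨e, he⟩ := α.exists_tendsto_orbit (-(a + a)) x'
  have hxx' : x < x' := (hμ _).1 (by rw [map_add]; linarith)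
  refine ⟨V ⊤ - V ⊥, fun b hb hba z hz => ?_⟩
  have hu : uIcc x' (α.T (-(a + a)) x') = Icc x x' := by rw [hcancel, uIcc_of_ge hxx'.le]
  have hax' : α.T a x ≤ x' := α.T_le_of_le hμ (by rw [map_add]; linarith)
  have h1 : α.T b z ∈ Icc x x' := by
    refine ⟨((hμ b).1 hb).le.trans ((α.T_le b).2 hz.1), ((α.T_le b).2 hz.2).trans ?_⟩
    rw [← α.T_add]
    exact α.T_le_of_le hμ (by rw [map_add, map_add]; linarith)
  have h2 := α.distortion_limit (b := b) hV hV' (hu ▸ ⟨hz.1, hz.2.trans hax'⟩) (hu ▸ h1) he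
    (fun n => abs_sub_le_of_monotone hV _ _)
  have h3 : 0 ≤ α.ℓ b e := by
    refine α.ℓ_nonneg_of_antitone (hcancel.symm ▸ hxx') he ?_
    rw [hx', α.T_comm, α.T_lt]
    exact (hμ b).1 hb
  linarith [(abs_le.1 h2).1]

/-- Orbits have no gaps: elements of small translation move `x` by a small amount. -/
theorem exists_T_lt {μ : A →+ ℝ} {x : I} (hμ : ∀ a, 0 < μ a ↔ x < α.T a x)
    (hdense : ∀ δ > 0, ∃ c, 0 < μ c ∧ μ c < δ) {u : I} (hu : x < u) :
    ∃ a, 0 < μ a ∧ α.T a x < u := by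
  by_contra! hall
  obtain ⟨a, ha, -⟩ := hdense 1 one_pos
  obtain ⟨C, hC⟩ := α.exists_forall_le_ℓ hμ ha
  set L := Real.exp (-C) * ((u : ℝ) - x) with hL
  have hLpos : 0 < L := mul_pos (Real.exp_pos _) (sub_pos.2 hu)
  obtain ⟨N, hN⟩ := exists_nat_gt (1 / L)
  have hNpos : (0 : ℝ) < N := lt_trans (by positivity) hN
  obtain ⟨c, hc, hca⟩ := hdense (μ a / N) (div_pos ha hNpos)
  rw [lt_div_iff₀ hNpos] at hca
  -- the images of `[x, u]` under the multiples of `c` do not overlap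
  have hlen : ∀ k ∈ Finset.range N,
      L ≤ (α.T ((k + 1 + 1) • c) x : ℝ) - α.T ((k + 1) • c) x := by
    intro k hk
    have hkN : ((k + 1 : ℕ) : ℝ) ≤ N := by exact_mod_cast Finset.mem_range.1 hk
    have hμk : μ ((k + 1) • c) = ((k + 1 : ℕ) : ℝ) * μ c := by
      rw [map_nsmul, nsmul_eq_mul]
    obtain ⟨ξ, h1, h2, h3⟩ := α.exists_mvt ((k + 1) • c) hu
    have h4 : -C ≤ α.ℓ ((k + 1) • c) ξ := by
      refine hC _ ?_ ?_ ξ ⟨h1.le, h2.le.trans (hall a ha)⟩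
      · rw [hμk]; positivity
      · rw [hμk]; nlinarith
    have h5 : α.T ((k + 1) • c) u ≤ α.T ((k + 1 + 1) • c) x := by
      rw [α.T_succ c (k + 1), α.T_le]
      exact hall c hc
    have h6 : L ≤ (α.T ((k + 1) • c) u : ℝ) - α.T ((k + 1) • c) x := by
      rw [h3]
      exact mul_le_mul_of_nonneg_right (Real.exp_le_exp.2 h4) (sub_nonneg.2 hu.le)
    have h7 : (α.T ((k + 1) • c) u : ℝ) ≤ α.T ((k + 1 + 1) • c) x := h5
    linarith
  have hsum := Finset.sum_le_sum hlen
  rw [Finset.sum_range_sub (fun k => (α.T ((k + 1) • c) x : ℝ)), Finset.sum_const,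
    Finset.card_range, nsmul_eq_mul] at hsum
  rw [div_lt_iff₀ hLpos] at hN
  have h1 := (α.T ((N + 1) • c) x).2.2
  have h2 := (α.T ((0 + 1) • c) x).2.1
  linarith

/-! ### Convergence to the identity -/

/-- The elements of the group whose translation `τ` is small. -/
def small (τ : A →+ ℝ) : Filter A := comap τ (𝓝 0)

theorem tendsto_small (τ : A →+ ℝ) : Tendsto τ (small τ) (𝓝 0) := tendsto_comap

theorem tendsto_neg_small (τ : A →+ ℝ) : Tendsto (fun a => -a) (small τ) (small τ) := by
  refine tendsto_comap_iff.2 ?_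
  have := (tendsto_small τ).neg
  rw [neg_zero] at this
  exact this.congr fun a => (map_neg τ a).symm

theorem pos_of_not_isFixed {x : I} (hx : ¬α.IsFixed x) : 0 < x :=
  lt_of_le_of_ne bot_le fun h => hx (h ▸ α.isFixed_zero)

theorem lt_one_of_not_isFixed {x : I} (hx : ¬α.IsFixed x) : x < 1 :=
  lt_of_le_of_ne le_top fun h => hx (h ▸ α.isFixed_one)

variable {τ : A →+ ℝ} (hτ : DenseRange τ) (hcal : ∀ x : I, 0 < x → x < 1 → α.Calibrates τ x)

include hcal in
theorem exists_scale {x : I} (hx : ¬α.IsFixed x) :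
    ∃ s : ℝ, s ≠ 0 ∧ ∀ a, 0 < (AddMonoidHom.mulLeft s).comp τ a ↔ x < α.T a x := by
  obtain ⟨s, hs, -, h⟩ := hcal x (α.pos_of_not_isFixed hx) (α.lt_one_of_not_isFixed hx)
  exact ⟨s, hs, h hx⟩

include hτ in
theorem exists_small_pos {s : ℝ} (hs : s ≠ 0) {δ : ℝ} (hδ : 0 < δ) :
    ∃ c, 0 < s * τ c ∧ s * τ c < δ := by
  have h1 : 0 < δ / |s| := div_pos hδ (abs_pos.2 hs)
  obtain ⟨c, hc⟩ := hτ.exists_mem_open isOpen_Ioo (nonempty_Ioo.2 h1)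
  have h2 := (lt_div_iff₀ (abs_pos.2 hs)).1 hc.2
  rcases lt_or_gt_of_ne hs with h | h
  · refine ⟨-c, ?_, ?_⟩
    · rw [map_neg]; nlinarith [hc.1]
    · rw [abs_of_neg h] at h2
      rw [map_neg]; nlinarith
  · refine ⟨c, mul_pos h hc.1, ?_⟩
    rw [abs_of_pos h] at h2
    linarith

include hτ hcal in
theorem eventually_T_lt {x u : I} (hu : x < u) : ∀ᶠ b in small τ, α.T b x < u := by
  by_cases hx : α.IsFixed x
  · exact Eventually.of_forall fun b => (hx b).symm ▸ hu
  obtain ⟨s, hs, h⟩ := α.exists_scale hcal hx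
  obtain ⟨a, ha, hau⟩ := α.exists_T_lt h (fun δ hδ => exists_small_pos hτ hs hδ) hu
  have h1 : Tendsto (fun b => (AddMonoidHom.mulLeft s).comp τ b) (small τ) (𝓝 (s * 0)) :=
    (tendsto_small τ).const_mul s
  rw [mul_zero] at h1
  filter_upwards [h1.eventually_lt_const ha] with b hb
  exact (α.T_lt_of_lt h hb).trans hau

include hτ hcal in
theorem eventually_lt_T {x u : I} (hu : u < x) : ∀ᶠ b in small τ, u < α.T b x := by
  filter_upwards [(tendsto_neg_small τ).eventually (α.eventually_T_lt hτ hcal hu)] with b hb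
  rwa [α.T_neg_lt_iff] at hb

include hτ hcal in
theorem tendsto_T (x : I) : Tendsto (fun p : A × I => α.T p.1 p.2) (small τ ×ˢ 𝓝 x) (𝓝 x) := by
  refine tendsto_order.2 ⟨fun u hu => ?_, fun u hu => ?_⟩
  · obtain ⟨m, h1, h2⟩ := exists_between hu
    filter_upwards [(α.eventually_lt_T hτ hcal h1).prod_mk (lt_mem_nhds h2)] with p hp
    exact hp.1.trans ((α.T_lt _).2 hp.2)
  · obtain ⟨m, h1, h2⟩ := exists_between hu
    filter_upwards [(α.eventually_T_lt hτ hcal h2).prod_mk (gt_mem_nhds h1)] with p hp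
    exact ((α.T_lt _).2 hp.2).trans hp.1

include hcal in
/-- At every global fixed point, endpoints included, `log D(·)(e)` is a multiple of `τ`. If `e` is a
limit of other global fixed points, it is zero. -/
theorem exists_ℓ_eq_mul_of_isFixed {e : I} (he : α.IsFixed e) : ∃ c, ∀ b, α.ℓ b e = c * τ b := by
  by_cases h : ∀ᶠ y in 𝓝 e, y ≠ e → ¬α.IsFixed y
  · obtain ⟨y₀, hy₀⟩ : ∃ y₀ : I, y₀ ≠ e := exists_ne e
    obtain ⟨y, ⟨-, hne, -⟩, hy⟩ :=
      ((frequently_mem_uIcc hy₀).and_eventually (eventually_forall_uIcc h)).exists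
    obtain ⟨s, hs, hμ⟩ := α.exists_scale hcal (hy y right_mem_uIcc hne)
    obtain ⟨c, hc⟩ := α.exists_ℓ_eq_mul he hne hy hμ
    exact ⟨c * s, fun b => by rw [hc b, mul_assoc]; rfl⟩
  · refine ⟨0, fun b => ?_⟩
    rw [zero_mul]
    by_contra hb
    refine h ?_
    filter_upwards [α.eventually_pos_of_ℓ_ne_zero (he b) hb] with y hy hne hfix
    have := hy hne
    rw [hfix b] at this
    simp at this

/-- The one-sided oscillation of a monotone function at a point vanishes, whether or not the function
is continuous there. -/
theorem eventually_abs_sub_le {V : I → ℝ} (hV : Monotone V) (e : I) {ε : ℝ} (hε : 0 < ε) :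
    ∀ᶠ x in 𝓝 e, ∀ z ∈ uIcc e x, z ≠ e → |V z - V x| ≤ ε := by
  have h1 := (hV.tendsto_nhdsGT e).eventually (Metric.ball_mem_nhds _ (half_pos hε))
  have h2 := (hV.tendsto_nhdsLT e).eventually (Metric.ball_mem_nhds _ (half_pos hε))
  rw [eventually_nhdsWithin_iff] at h1 h2
  filter_upwards [eventually_forall_uIcc (h1.and h2)] with x hx z hz hne
  have hx1 := hx x right_mem_uIcc
  have hz1 := hx z hz
  have key : ∀ L, V z ∈ Metric.ball L (ε / 2) → V x ∈ Metric.ball L (ε / 2) →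
      |V z - V x| ≤ ε := by
    intro L h h'
    rw [Metric.mem_ball, dist_comm] at h'
    have := dist_triangle (V z) L (V x)
    rw [Metric.mem_ball] at h
    rw [← Real.dist_eq]
    linarith
  rcases mem_uIcc.1 hz with h | h
  · have hez : e < z := lt_of_le_of_ne h.1 hne.symm
    exact key _ (hz1.1 hez) (hx1.1 (hez.trans_le h.2))
  · have hez : z < e := lt_of_le_of_ne h.2 hne
    exact key _ (hz1.2 hez) (hx1.2 (h.1.trans_lt hez))

/-- Near a global fixed point `e`, a point `y` moved towards `e` by `a` can be compared with the
endpoint of its component on the side of `e`. -/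
theorem exists_isFixed_abs_ℓ_sub_le {a b : A} {V : I → ℝ} (hV : Monotone V)
    (hV' : ∀ x y, x ≤ y → |α.ℓ (a + a) y - α.ℓ (a + a) x| ≤ V y - V x) {e y : I} {ε : ℝ}
    (he : α.IsFixed e) (hay : α.T a y ∈ uIcc e y) (hne : α.T a y ≠ y)
    (hosc : ∀ z ∈ uIcc e (α.T (-a) y), z ≠ e → |V z - V (α.T (-a) y)| ≤ ε)
    (hb : α.T b y ∈ uIcc (α.T (-a) y) (α.T a y)) :
    ∃ e', α.IsFixed e' ∧ |α.ℓ b y - α.ℓ b e'| ≤ ε := by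
  set x := α.T (-a) y with hx
  have hTx : α.T (a + a) x = α.T a y := by rw [α.T_add, hx, α.T_T_neg]
  have hyx : y ∈ uIcc e x := by
    have := α.T_mem_uIcc (-a) hay
    rwa [he, α.T_neg_T] at this
  have hsub : uIcc e y ⊆ uIcc e x := uIcc_subset_uIcc left_mem_uIcc hyx
  have hye : y ≠ e := by
    rintro rfl
    exact hne (he a)
  have hxe : x ≠ e := by
    rintro h
    rw [h, uIcc_self] at hyx
    exact hye hyx
  have hyx' : y ∈ uIcc x (α.T (a + a) x) := by
    rw [hTx, mem_uIcc]
    rcases mem_uIcc.1 hay with h | h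
    · refine Or.inr ⟨h.2, ?_⟩
      rw [← α.T_le a, α.T_T_neg]
      exact h.2
    · refine Or.inl ⟨?_, h.1⟩
      rw [← α.T_le a, α.T_T_neg]
      exact h.1
  have horb : ∀ n : ℕ, α.T (n • (a + a)) x ∈ uIcc e x := by
    intro n
    induction n with
    | zero => rw [zero_smul, α.T_zero]; exact right_mem_uIcc
    | succ n ih =>
      have h := α.T_mem_uIcc (a + a) ih
      rw [he, hTx, ← α.T_add, ← succ_nsmul'] at h
      exact hsub (uIcc_subset_uIcc left_mem_uIcc hay h)
  obtain ⟨e', he'⟩ := α.exists_tendsto_orbit (a + a) x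
  have hmove : α.T (a + a) x ≠ x := by
    intro h
    rw [h, uIcc_self] at hyx'
    rw [hTx, ← hyx'] at h
    exact hne h
  refine ⟨e', α.isFixed_of_tendsto hmove he', ?_⟩
  refine α.distortion_limit hV hV' hyx' (hTx.symm ▸ hb) he' fun n => hosc _ (horb n) ?_
  rw [← he (n • (a + a))]
  exact fun h => hxe ((α.T _).injective h)

include hτ hcal in
/-- Elements of small translation have derivative close to `1` near a global fixed point `e`. The
point `e` may be a limit of other global fixed points, on one side or both. -/
theorem tendsto_ℓ_of_isFixed {e : I} (he : α.IsFixed e) :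
    Tendsto (fun p : A × I => α.ℓ p.1 p.2) (small τ ×ˢ 𝓝 e) (𝓝 0) := by
  rw [Metric.tendsto_nhds]
  intro ε hε
  obtain ⟨a, ha, -⟩ := exists_small_pos hτ one_ne_zero one_pos
  rw [one_mul] at ha
  -- both `a²` and `a⁻²` are needed: which one moves a point towards `e` depends on its component
  obtain ⟨V, hV, hV'⟩ := α.exists_variation (a + a)
  obtain ⟨W, hW, hW'⟩ := α.exists_variation (-a + -a)
  obtain ⟨M, hM, hMa⟩ := α.exists_bound a
  have hε3 : 0 < ε / 3 := by positivity
  -- at global fixed points, `ℓ b` is small uniformly because it is proportional to `τ b`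
  have hfixed : ∀ᶠ b in small τ, ∀ e', α.IsFixed e' → |α.ℓ b e'| ≤ ε / 3 := by
    have h1 : Tendsto (fun b => |τ b| * M / τ a) (small τ) (𝓝 (|0| * M / τ a)) :=
      ((tendsto_small τ).abs.mul_const M).div_const _
    rw [abs_zero, zero_mul, zero_div] at h1
    filter_upwards [h1.eventually_lt_const hε3] with b hb e' he'
    obtain ⟨c, hc⟩ := α.exists_ℓ_eq_mul_of_isFixed hcal he'
    have h2 : α.ℓ b e' = τ b * α.ℓ a e' / τ a := by
      rw [hc b, hc a]
      field_simp
    rw [h2, abs_div, abs_mul, abs_of_pos ha]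
    refine le_trans ?_ hb.le
    gcongr
    exact hMa e'
  have hsmall : ∀ᶠ b in small τ, |τ b| < τ a := by
    have h1 := (tendsto_small τ).abs
    rw [abs_zero] at h1
    exact h1.eventually_lt_const ha
  have hVe : ∀ᶠ y in 𝓝 e, ∀ z ∈ uIcc e (α.T (-a) y), z ≠ e →
      |V z - V (α.T (-a) y)| ≤ ε / 3 := by
    have h := (α.continuous_T (-a)).tendsto e
    rw [he] at h
    exact h.eventually (eventually_abs_sub_le hV e hε3)
  have hWe : ∀ᶠ y in 𝓝 e, ∀ z ∈ uIcc e (α.T (- -a) y), z ≠ e →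
      |W z - W (α.T (- -a) y)| ≤ ε / 3 := by
    have h := (α.continuous_T (- -a)).tendsto e
    rw [he] at h
    exact h.eventually (eventually_abs_sub_le hW e hε3)
  filter_upwards [(hfixed.and hsmall).prod_mk (hVe.and hWe)] with p hp
  obtain ⟨b, y⟩ := p
  obtain ⟨⟨hb1, hb2⟩, hy1, hy2⟩ := hp
  simp only at hb1 hb2 hy1 hy2 ⊢
  rw [dist_zero_right, Real.norm_eq_abs]
  by_cases hy : α.IsFixed y
  · linarith [hb1 y hy]
  suffices ∃ e', α.IsFixed e' ∧ |α.ℓ b y - α.ℓ b e'| ≤ ε / 3 by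
    obtain ⟨e', h1, h2⟩ := this
    have h3 := hb1 e' h1
    have h4 := abs_sub_abs_le_abs_sub (α.ℓ b y) (α.ℓ b e')
    linarith
  obtain ⟨s, hs, hμ⟩ := α.exists_scale hcal hy
  have hmem : α.T b y ∈ uIcc (α.T (-a) y) (α.T a y) := by
    rw [abs_lt] at hb2
    rw [mem_uIcc]
    rcases lt_or_gt_of_ne hs with h | h
    · refine Or.inr ⟨α.T_le_of_le hμ ?_, α.T_le_of_le hμ ?_⟩
      · change s * τ a ≤ s * τ b
        nlinarith
      · change s * τ b ≤ s * τ (-a)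
        rw [map_neg]
        nlinarith
    · refine Or.inl ⟨α.T_le_of_le hμ ?_, α.T_le_of_le hμ ?_⟩
      · change s * τ (-a) ≤ s * τ b
        rw [map_neg]
        nlinarith
      · change s * τ b ≤ s * τ a
        nlinarith
  have hne : α.T a y ≠ y := by
    intro h
    rw [α.T_eq_iff_not, ← hμ, ← hμ] at h
    obtain ⟨h1, h2⟩ := h
    change ¬0 < s * τ a at h1
    change ¬0 < s * τ (-a) at h2
    rw [map_neg] at h2
    rcases lt_or_gt_of_ne hs with h | h <;> nlinarith
  have hcases : α.T a y ∈ uIcc e y ∨ α.T (-a) y ∈ uIcc e y := by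
    rw [mem_uIcc, mem_uIcc]
    have hcmp : ∀ c, (e ≤ α.T c y ↔ e ≤ y) ∧ (α.T c y ≤ e ↔ y ≤ e) := fun c => by
      constructor
      · rw [← he c, α.T_le, he c]
      · rw [← he c, α.T_le, he c]
    have hle : α.T (-a) y ≤ y ↔ y ≤ α.T a y := by rw [← α.T_le a, α.T_T_neg]
    have hge : y ≤ α.T (-a) y ↔ α.T a y ≤ y := by rw [← α.T_le a, α.T_T_neg]
    simp only [(hcmp _).1, (hcmp _).2, hle, hge]
    rcases le_total e y with h1 | h1 <;> rcases le_total y (α.T a y) with h2 | h2 <;> simp [h1, h2]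
  rcases hcases with h | h
  · exact α.exists_isFixed_abs_ℓ_sub_le hV hV' he h hne hy1 hmem
  · refine α.exists_isFixed_abs_ℓ_sub_le hW hW' he h (fun h' => hne ((α.T_neg_eq_iff a y).1 h'))
      hy2 ?_
    rwa [neg_neg, uIcc_comm]

include hτ hcal in
theorem tendsto_ℓ (x : I) :
    Tendsto (fun p : A × I => α.ℓ p.1 p.2) (small τ ×ˢ 𝓝 x) (𝓝 0) := by
  by_cases hx : α.IsFixed x
  · exact α.tendsto_ℓ_of_isFixed hτ hcal hx
  obtain ⟨a, ha⟩ := not_forall.1 hx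
  obtain ⟨e, he⟩ := α.exists_tendsto_orbit a x
  have hfix := α.isFixed_of_tendsto ha he
  rw [Metric.tendsto_nhds]
  intro ε hε
  -- the estimate near the end `e` of the orbit is transported to `x` along finitely many steps
  have h1 := Metric.tendsto_nhds.1 (α.tendsto_ℓ_of_isFixed hτ hcal hfix) (ε / 2) (half_pos hε)
  obtain ⟨P, hP, Q, hQ, hPQ⟩ := eventually_prod_iff.1 h1
  obtain ⟨n, hn⟩ := (he.eventually hQ.eventually_nhds).exists
  have h2 : Tendsto (fun p : A × I => ∑ k ∈ Finset.range n,
      (α.ℓ a (α.T (k • a) p.2) - α.ℓ a (α.T (k • a) (α.T p.1 p.2)))) (small τ ×ˢ 𝓝 x)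
      (𝓝 (∑ k ∈ Finset.range n, (α.ℓ a (α.T (k • a) x) - α.ℓ a (α.T (k • a) x)))) := by
    refine tendsto_finsetSum _ fun k _ => ?_
    have hc : Tendsto (fun y => α.ℓ a (α.T (k • a) y)) (𝓝 x) (𝓝 (α.ℓ a (α.T (k • a) x))) :=
      ((α.continuous_ℓ a).comp (α.continuous_T _)).tendsto x
    exact (hc.comp tendsto_snd).sub (hc.comp (α.tendsto_T hτ hcal x))
  simp only [sub_self, Finset.sum_const_zero] at h2
  have h3 := Metric.tendsto_nhds.1 h2 (ε / 2) (half_pos hε)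
  have h4 : ∀ᶠ y in 𝓝 x, Q (α.T (n • a) y) := ((α.continuous_T _).tendsto x).eventually hn
  filter_upwards [h3, hP.prod_mk h4] with p hp1 hp2
  have h5 := hPQ hp2.1 hp2.2
  rw [dist_zero_right] at hp1 h5 ⊢
  rw [α.ℓ_eq_add_sum a p.1 p.2 n]
  exact (norm_add_le _ _).trans_lt (by simp only at h5; linarith)

include hτ hcal in
/-- Elements of small translation are uniformly `C¹`-close to the identity. -/
theorem eventually_abs_ℓ_lt {ε : ℝ} (hε : 0 < ε) : ∀ᶠ b in small τ, ∀ x, |α.ℓ b x| < ε := by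
  have h : TendstoLocallyUniformly α.ℓ (fun _ => (0 : ℝ)) (small τ) := by
    rw [tendstoLocallyUniformly_iff_forall_tendsto]
    intro x
    refine Tendsto.mono_right ?_ (nhds_le_uniformity (0 : ℝ))
    rw [nhds_prod_eq]
    exact tendsto_const_nhds.prodMk (α.tendsto_ℓ hτ hcal x)
  rw [tendstoLocallyUniformly_iff_tendstoUniformly_of_compactSpace] at h
  filter_upwards [Metric.tendstoUniformly_iff.1 h ε hε] with b hb x
  simpa [dist_comm] using hb x

theorem abs_T_sub_le (b : A) {ε : ℝ} (hε : ε ≤ 1) (h : ∀ x, |α.ℓ b x| ≤ ε) (x : I) :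
    |(α.T b x : ℝ) - x| ≤ 2 * ε := by
  obtain ⟨c, -, hc⟩ := α.exists_mvt_uIcc b x 0
  rw [α.isFixed_zero b] at hc
  have h1 : (α.T b x : ℝ) - x = (Real.exp (α.ℓ b c) - 1) * x := by
    simp only [Icc.coe_zero, sub_zero] at hc
    rw [hc]
    ring
  have h2 := Real.abs_exp_sub_one_le ((h c).trans hε)
  rw [h1, abs_mul, abs_of_nonneg x.2.1]
  have h3 := mul_le_of_le_one_right (abs_nonneg (Real.exp (α.ℓ b c) - 1)) x.2.2
  linarith [h c]

theorem T_eq_of_eq_zero (hcal : ∀ x : I, 0 < x → x < 1 → α.Calibrates τ x) {b : A}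
    (hb : τ b = 0) (x : I) : α.T b x = x := by
  by_cases hx : α.IsFixed x
  · exact hx b
  obtain ⟨s, -, h⟩ := α.exists_scale hcal hx
  rw [α.T_eq_iff_not, ← h, ← h]
  simp [hb]

end LogDerivAction

/-! ### The logarithmic derivative on `Diff¹₊([0,1])` -/

theorem D_pos (f : Diff1) {x : ℝ} (hx : x ∈ Icc (0 : ℝ) 1) : 0 < D f x := by
  refine lt_of_le_of_ne (MonotoneOn.derivWithin_nonneg ?_) (D_ne_zero f hx).symm
  intro a ha b hb hab
  rw [toFun_of_mem _ ha, toFun_of_mem _ hb]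
  exact f.1.monotone hab

theorem logD_apply (f : Diff1) (x : I) : logD f x = Real.log (D f x) := rfl

theorem exp_logD (f : Diff1) (x : I) : Real.exp (logD f x) = D f x :=
  Real.exp_log (D_pos f x.2)

theorem toCont_apply (f : Diff1) (x : I) : toCont f x = f.1 x := rfl

theorem logD_eq_of_hasDerivWithinAt {f : Diff1} {x : I} {r : ℝ}
    (h : HasDerivWithinAt (toFun f.1) (Real.exp r) (Icc 0 1) x) : logD f x = r := by
  rw [logD_apply, D, h.derivWithin (uniqueDiffOn_Icc zero_lt_one x x.2), Real.log_exp]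

theorem logD_mul (f g : Diff1) (x : I) : logD (f * g) x = logD f (g.1 x) + logD g x := by
  apply logD_eq_of_hasDerivWithinAt
  have h1 := hasDerivWithinAt g x.2
  have h2 := (hasDerivWithinAt f (mapsTo_toFun g.1 x.2)).scomp (x : ℝ) h1 (mapsTo_toFun g.1)
  rw [toFun_coe, smul_eq_mul, mul_comm, ← exp_logD, ← exp_logD, ← Real.exp_add] at h2
  exact h2.congr (fun y hy => toFun_mul _ _ hy) (toFun_mul _ _ x.2)

theorem logD_one (x : I) : logD 1 x = 0 := by
  have := logD_mul 1 1 x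
  rw [mul_one] at this
  change logD 1 x = logD 1 x + logD 1 x at this
  linarith

theorem exists_eq_exp_logD_mul (f : Diff1) {x y : I} (h : x < y) :
    ∃ c, x < c ∧ c < y ∧ (f.1 y : ℝ) - f.1 x = Real.exp (logD f c) * (y - x) := by
  have h' : (x : ℝ) < y := h
  obtain ⟨c, hc, hc'⟩ := exists_hasDerivAt_eq_slope (toFun f.1) (D f) h'
    (f.2.1.continuousOn.mono (Icc_subset_Icc x.2.1 y.2.2)) (fun z hz =>
      (hasDerivWithinAt f ⟨x.2.1.trans hz.1.le, hz.2.le.trans y.2.2⟩).hasDerivAt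
        (Icc_mem_nhds (x.2.1.trans_lt hz.1) (hz.2.trans_le y.2.2)))
  refine ⟨⟨c, x.2.1.trans hc.1.le, hc.2.le.trans y.2.2⟩, hc.1, hc.2, ?_⟩
  rw [exp_logD]
  simp only [toFun_coe] at hc'
  rw [hc', div_mul_cancel₀ _ (sub_pos.2 h').ne']

theorem lipschitzOnWith_log {m : NNReal} (hm : 0 < m) :
    LipschitzOnWith m⁻¹ Real.log (Ici (m : ℝ)) := by
  have key : ∀ x ∈ Ici (m : ℝ), ∀ y ∈ Ici (m : ℝ), Real.log x - Real.log y ≤ (m : ℝ)⁻¹ * |x - y| := by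
    intro x hx y hy
    have hm' : (0 : ℝ) < m := hm
    have hx0 : 0 < x := hm'.trans_le hx
    have hy0 : 0 < y := hm'.trans_le hy
    rw [← Real.log_div hx0.ne' hy0.ne']
    calc Real.log (x / y) ≤ x / y - 1 := Real.log_le_sub_one_of_pos (by positivity)
      _ = y⁻¹ * (x - y) := by field_simp
      _ ≤ y⁻¹ * |x - y| := by gcongr; exact le_abs_self _
      _ ≤ (m : ℝ)⁻¹ * |x - y| := by gcongr; exact hy
  refine LipschitzOnWith.of_dist_le_mul fun x hx y hy => ?_
  rw [Real.dist_eq, Real.dist_eq, NNReal.coe_inv]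
  refine abs_le'.2 ⟨key x hx y hy, ?_⟩
  rw [neg_sub, abs_sub_comm]
  exact key y hy x hx

theorem exists_monotone_variation {f : Diff1} (hf : IsC1bv f) :
    ∃ V : I → ℝ, Monotone V ∧ ∀ x y, x ≤ y → |logD f y - logD f x| ≤ V y - V x := by
  obtain ⟨x₀, hx₀, hmin⟩ := isCompact_Icc.exists_isMinOn (nonempty_Icc.2 zero_le_one)
    (continuousOn_D f)
  let m : NNReal := ⟨D f x₀, (D_pos f hx₀).le⟩
  have hm : 0 < m := D_pos f hx₀
  have hbv : BoundedVariationOn (Real.log ∘ D f) (Icc 0 1) :=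
    (lipschitzOnWith_log hm).comp_boundedVariationOn (fun x hx => hmin hx) hf
  obtain ⟨p, q, hp, hq, hpq⟩ := hbv.locallyBoundedVariationOn.exists_monotoneOn_sub_monotoneOn
  have heq : ∀ x : I, logD f x = p x - q x := fun x => congrFun hpq x
  refine ⟨fun x => p x + q x, fun x y h => add_le_add (hp x.2 y.2 h) (hq x.2 y.2 h),
    fun x y h => ?_⟩
  have h1 := hp x.2 y.2 h
  have h2 := hq x.2 y.2 h
  rw [heq, heq, abs_le]
  constructor <;> linarith

/-- The action on `[0,1]` defined by a `C^{1+bv}` action, with its logarithmic derivatives. -/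
noncomputable def logDerivAction {A : Type*} [AddCommGroup A] (ρ : Multiplicative A →* Diff1)
    (hbv : ∀ v, IsC1bv (ρ v)) : LogDerivAction A where
  T a := (ρ (Multiplicative.ofAdd a)).1
  ℓ a := logD (ρ (Multiplicative.ofAdd a))
  T_add a b x := by rw [ofAdd_add, map_mul]; rfl
  continuous_ℓ a := (logD _).continuous
  ℓ_add a b x := by rw [ofAdd_add, map_mul, logD_mul]
  exists_mvt a _ _ h := exists_eq_exp_logD_mul _ h
  exists_variation a := exists_monotone_variation (hbv _)

/-! ### Extension of a homomorphism from a dense group of times -/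

theorem dist_mul_right_le (f g h : Diff1) : dist (f * h) (g * h) ≤ dist f g := by
  refine add_le_add ?_ ?_
  · refine (ContinuousMap.norm_le _ (norm_nonneg _)).2 fun x => ?_
    exact (toCont f - toCont g).norm_coe_le_norm (h.1 x)
  · refine (ContinuousMap.norm_le _ (norm_nonneg _)).2 fun x => ?_
    rw [ContinuousMap.sub_apply, logD_mul, logD_mul, add_sub_add_right_eq_sub]
    exact (logD f - logD g).norm_coe_le_norm (h.1 x)

theorem dist_one_le {f : Diff1} {ε : ℝ} (hε : 0 ≤ ε) (h1 : ∀ x : I, |(f.1 x : ℝ) - x| ≤ 2 * ε)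
    (h2 : ∀ x : I, |logD f x| ≤ ε) : dist f 1 ≤ 3 * ε := by
  have e1 : ‖toCont f - toCont 1‖ ≤ 2 * ε :=
    (ContinuousMap.norm_le _ (by positivity)).2 h1
  have e2 : ‖logD f - logD 1‖ ≤ ε := by
    refine (ContinuousMap.norm_le _ hε).2 fun x => ?_
    rw [ContinuousMap.sub_apply, logD_one, sub_zero]
    exact h2 x
  change ‖toCont f - toCont 1‖ + ‖logD f - logD 1‖ ≤ 3 * ε
  linarith

/-- The integral form of the relation between `f` and `log Df`, which passes to uniform limits. -/
theorem toCont_eq_integral (f : Diff1) (x : I) :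
    toCont f x = ∫ y in (0 : ℝ)..x, Real.exp (logD f (projIcc 0 1 zero_le_one y)) := by
  have hc : Continuous fun y => Real.exp (logD f (projIcc 0 1 zero_le_one y)) :=
    Real.continuous_exp.comp ((logD f).continuous.comp continuous_projIcc)
  rw [intervalIntegral.integral_eq_sub_of_hasDerivAt_of_le x.2.1
    (f := toFun f.1) (f.2.1.continuousOn.mono (Icc_subset_Icc le_rfl x.2.2)) (fun y hy => ?_)
    (hc.intervalIntegrable _ _)]
  · have h0 : toFun f.1 0 = 0 := by
      rw [toFun_of_mem _ ⟨le_rfl, zero_le_one⟩]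
      exact congrArg Subtype.val f.1.map_bot
    rw [h0, sub_zero, toFun_coe, toCont_apply]
  · have hy' : y ∈ Icc (0 : ℝ) 1 := ⟨hy.1.le, hy.2.le.trans x.2.2⟩
    rw [exp_logD, projIcc_of_mem _ hy']
    exact (hasDerivWithinAt f hy').hasDerivAt (Icc_mem_nhds hy.1 (hy.2.trans_le x.2.2))

/-- A one-parameter group of increasing maps of `[0,1]`, given as real-valued continuous functions
`F t`, each of which is a primitive of `exp (L t)`. No continuity in `t` is required. -/
structure PreFlow (F L : ℝ → C(I, ℝ)) : Prop where
  mem : ∀ t x, F t x ∈ Icc (0 : ℝ) 1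
  mono : ∀ t, Monotone (F t)
  zero : ∀ x, F 0 x = x
  add : ∀ s t x, F (s + t) x = F s ⟨F t x, mem t x⟩
  eq_integral : ∀ t (x : I),
    F t x = ∫ y in (0 : ℝ)..x, Real.exp (L t (projIcc 0 1 zero_le_one y))

namespace PreFlow

variable {F L : ℝ → C(I, ℝ)} (h : PreFlow F L)

include h

theorem neg_apply (t : ℝ) (x : I) : F (-t) ⟨F t x, h.mem t x⟩ = x := by
  rw [← h.add, neg_add_cancel, h.zero]

/-- The time-`t` map as an increasing bijection. -/
def iso (t : ℝ) : I ≃o I where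
  toFun x := ⟨F t x, h.mem t x⟩
  invFun x := ⟨F (-t) x, h.mem (-t) x⟩
  left_inv x := Subtype.ext (h.neg_apply t x)
  right_inv x := Subtype.ext (by
    have := h.neg_apply (-t) x
    rwa [neg_neg] at this)
  map_rel_iff' {x y} := by
    refine ⟨fun hxy => ?_, fun hxy => h.mono t hxy⟩
    have := h.mono (-t) hxy
    simp only [Equiv.coe_fn_mk, h.neg_apply] at this
    exact this

theorem iso_apply (t : ℝ) (x : I) : (h.iso t x : ℝ) = F t x := rfl

theorem iso_add (s t : ℝ) : h.iso (s + t) = h.iso s * h.iso t := by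
  ext x
  exact h.add s t x

theorem iso_zero : h.iso 0 = 1 := by
  ext x
  exact h.zero x

theorem iso_neg (t : ℝ) : h.iso (-t) = (h.iso t)⁻¹ := by
  rw [eq_inv_iff_mul_eq_one, ← h.iso_add, neg_add_cancel, h.iso_zero]

theorem toFun_iso (t : ℝ) {x : ℝ} (hx : x ∈ Icc (0 : ℝ) 1) :
    IntervalDiff.toFun (h.iso t) x
      = ∫ y in (0 : ℝ)..x, Real.exp (L t (projIcc 0 1 zero_le_one y)) := by
  rw [toFun_of_mem _ hx, h.iso_apply, h.eq_integral]

omit h in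
theorem continuous_integrand (t : ℝ) :
    Continuous fun y => Real.exp (L t (projIcc 0 1 zero_le_one y)) :=
  Real.continuous_exp.comp ((L t).continuous.comp continuous_projIcc)

theorem contDiffOn_iso (t : ℝ) : ContDiffOn ℝ 1 (IntervalDiff.toFun (h.iso t)) (Icc 0 1) := by
  have hc : Continuous fun y => Real.exp (L t (projIcc 0 1 zero_le_one y)) :=
    continuous_integrand t
  have hd := fun x => (hc.integral_hasStrictDerivAt 0 x).hasDerivAt
  have : ContDiff ℝ 1 fun x => ∫ y in (0 : ℝ)..x, Real.exp (L t (projIcc 0 1 zero_le_one y)) := by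
    refine contDiff_one_iff_deriv.2 ⟨fun x => (hd x).differentiableAt, ?_⟩
    rwa [funext fun x => (hd x).deriv]
  exact this.contDiffOn.congr fun x hx => h.toFun_iso t hx

/-- The flow of `C¹` diffeomorphisms. -/
def flow : Multiplicative ℝ →* Diff1 where
  toFun t := ⟨h.iso t.toAdd, h.contDiffOn_iso _, by rw [← h.iso_neg]; exact h.contDiffOn_iso _⟩
  map_one' := Subtype.ext h.iso_zero
  map_mul' s t := Subtype.ext (h.iso_add s.toAdd t.toAdd)

theorem toCont_flow (t : Multiplicative ℝ) : toCont (h.flow t) = F t.toAdd := by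
  ext x
  rfl

theorem logD_flow (t : Multiplicative ℝ) : logD (h.flow t) = L t.toAdd := by
  ext x
  apply logD_eq_of_hasDerivWithinAt
  have hd := ((continuous_integrand (L := L) t.toAdd).integral_hasStrictDerivAt 0 x).hasDerivAt
  simp only [projIcc_val] at hd
  exact hd.hasDerivWithinAt.congr (fun y hy => h.toFun_iso _ hy) (h.toFun_iso _ x.2)

theorem continuous_flow (hF : Continuous F) (hL : Continuous L) : Continuous h.flow := by
  rw [continuous_iff_continuousAt]
  intro t
  rw [ContinuousAt, tendsto_iff_dist_tendsto_zero]
  have h1 : Continuous fun s : Multiplicative ℝ =>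
      ‖F s.toAdd - F t.toAdd‖ + ‖L s.toAdd - L t.toAdd‖ :=
    ((hF.comp continuous_toAdd).sub continuous_const).norm.add
      ((hL.comp continuous_toAdd).sub continuous_const).norm
  have h2 := h1.tendsto t
  simp only [sub_self, norm_zero, add_zero] at h2
  refine h2.congr fun s => ?_
  rw [← h.toCont_flow, ← h.toCont_flow, ← h.logD_flow, ← h.logD_flow]
  rfl

end PreFlow

/-- A homomorphism to `Diff¹₊([0,1])` which is continuous with respect to a dense group of times
extends to a flow: the distance is right-invariant, so the homomorphism is uniformly continuous, and
the pairs `(f, log Df)` converge in a complete space. -/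
theorem exists_flow_extension {A : Type*} [AddCommGroup A] (ρ : Multiplicative A →* Diff1)
    {τ : A →+ ℝ} (hτ : DenseRange τ)
    (hsmall : ∀ ε > 0, ∃ δ > 0, ∀ a, |τ a| < δ → dist (ρ (Multiplicative.ofAdd a)) 1 < ε) :
    ∃ φ : Multiplicative ℝ →* Diff1, Continuous φ ∧
      ∀ a, ρ (Multiplicative.ofAdd a) = φ (Multiplicative.ofAdd (τ a)) := by
  -- `A` carries the distance of the times, for which `τ` is uniformly inducing
  let _ : PseudoMetricSpace A := PseudoMetricSpace.induced τ inferInstance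
  have hind : IsUniformInducing τ := ⟨rfl⟩
  let Φ : A → C(I, ℝ) × C(I, ℝ) := fun a =>
    (toCont (ρ (Multiplicative.ofAdd a)), logD (ρ (Multiplicative.ofAdd a)))
  have hΦ : UniformContinuous Φ := by
    rw [Metric.uniformContinuous_iff]
    intro ε hε
    obtain ⟨δ, hδ, h⟩ := hsmall ε hε
    refine ⟨δ, hδ, fun {a b} hab => ?_⟩
    change dist (τ a) (τ b) < δ at hab
    rw [Real.dist_eq, ← map_sub] at hab
    have h1 := h _ hab
    have h2 := dist_mul_right_le (ρ (Multiplicative.ofAdd (a - b))) 1 (ρ (Multiplicative.ofAdd b))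
    rw [← map_mul, ← ofAdd_add, sub_add_cancel, one_mul] at h2
    refine lt_of_le_of_lt ?_ (h2.trans_lt h1)
    rw [Prod.dist_eq, dist_eq_norm, dist_eq_norm]
    exact max_le (le_add_of_nonneg_right (norm_nonneg _)) (le_add_of_nonneg_left (norm_nonneg _))
  obtain ⟨Ψ, hΨ, hΨΦ⟩ : ∃ Ψ : ℝ → C(I, ℝ) × C(I, ℝ), Continuous Ψ ∧ ∀ a, Ψ (τ a) = Φ a :=
    ⟨_, (uniformContinuous_uniformly_extend hind hτ hΦ).continuous,
      uniformly_extend_of_ind hind hτ hΦ⟩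
  let F : ℝ → C(I, ℝ) := fun t => (Ψ t).1
  let L : ℝ → C(I, ℝ) := fun t => (Ψ t).2
  have hF : Continuous F := continuous_fst.comp hΨ
  have hL : Continuous L := continuous_snd.comp hΨ
  have hFτ : ∀ a, F (τ a) = toCont (ρ (Multiplicative.ofAdd a)) := fun a =>
    congrArg Prod.fst (hΨΦ a)
  have hLτ : ∀ a, L (τ a) = logD (ρ (Multiplicative.ofAdd a)) := fun a =>
    congrArg Prod.snd (hΨΦ a)
  have hFx : ∀ x, Continuous fun t => F t x := fun x =>
    (continuous_eval_const x).comp hF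
  have hmem : ∀ t x, F t x ∈ Icc (0 : ℝ) 1 := by
    intro t x
    refine hτ.induction_on (p := fun t => F t x ∈ Icc (0 : ℝ) 1) t
      (isClosed_Icc.preimage (hFx x)) fun a => ?_
    rw [hFτ]
    exact ((ρ (Multiplicative.ofAdd a)).1 x).2
  have hpre : PreFlow F L := by
    refine ⟨hmem, fun t x y hxy => ?_, fun x => ?_, fun s t x => ?_, fun t x => ?_⟩
    · refine hτ.induction_on (p := fun t => F t x ≤ F t y) t
        (isClosed_le (hFx x) (hFx y)) fun a => ?_
      rw [hFτ]
      exact (ρ (Multiplicative.ofAdd a)).1.monotone hxy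
    · rw [← map_zero τ, hFτ, ofAdd_zero, map_one]
      rfl
    · refine hτ.induction_on₂
        (p := fun s t => F (s + t) x = F s ⟨F t x, hmem t x⟩) (isClosed_eq ?_ ?_) (fun a b => ?_) s t
      · exact (hFx x).comp continuous_add
      · refine continuous_eval.comp ((hF.comp continuous_fst).prodMk ?_)
        exact ((hFx x).comp continuous_snd).subtype_mk _
      · rw [← map_add]
        simp only [hFτ, toCont_apply, ofAdd_add, map_mul]
        rfl
    · refine hτ.induction_on (p := fun t =>
        F t x = ∫ y in (0 : ℝ)..x, Real.exp (L t (projIcc 0 1 zero_le_one y))) t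
        (isClosed_eq (hFx x) ?_) fun a => ?_
      · refine intervalIntegral.continuous_parametric_intervalIntegral_of_continuous' ?_ _ _
        refine Real.continuous_exp.comp (continuous_eval.comp
          ((hL.comp continuous_fst).prodMk ((continuous_projIcc (h := zero_le_one)).comp continuous_snd)))
      · rw [hFτ, hLτ]
        exact toCont_eq_integral _ x
  refine ⟨hpre.flow, hpre.continuous_flow hF hL, fun a => toCont_injective ?_⟩
  rw [hpre.toCont_flow, toAdd_ofAdd, hFτ]

/-! ### Embedding into a flow -/

/-- A subgroup of the real line is dense or cyclic, and the range of `τ` maps onto that of `ρ`. -/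
theorem denseRange_of_not_isCyclic {A G : Type*} [AddCommGroup A] [Group G]
    {ρ : Multiplicative A →* G} (hcyc : ¬IsCyclic ρ.range) {τ : A →+ ℝ}
    (hker : ∀ a, τ a = 0 → ρ (Multiplicative.ofAdd a) = 1) : DenseRange τ := by
  rcases τ.range.dense_or_cyclic with h | ⟨r, hr⟩
  · exact h
  refine (hcyc ?_).elim
  obtain ⟨a₀, ha₀⟩ : r ∈ τ.range := hr ▸ AddSubgroup.mem_closure_singleton_self r
  refine ⟨⟨⟨ρ (Multiplicative.ofAdd a₀), _, rfl⟩, ?_⟩⟩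
  rintro ⟨_, v, rfl⟩
  have h1 : τ v.toAdd ∈ AddSubgroup.closure {r} := hr ▸ ⟨_, rfl⟩
  obtain ⟨n, hn⟩ := AddSubgroup.mem_closure_singleton.1 h1
  refine ⟨n, Subtype.ext ?_⟩
  have h2 := hker (v.toAdd - n • a₀) (by rw [map_sub, map_zsmul, ha₀, hn, sub_self])
  rw [ofAdd_sub, ofAdd_toAdd, ofAdd_zsmul, map_div, map_zpow, div_eq_one] at h2
  simpa using h2.symm

end IntervalDiff

theorem mainTheorem6 (d : ℕ) (ρ : Multiplicative (Fin d → ℤ) →* IntervalDiff.Diff1)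
    (hbv : IntervalDiff.IsC1bvAction ρ)
    (hpar : ∀ p : unitInterval, 0 < p → p < 1 → ¬ IntervalDiff.IsParabolicGlobalFixedPoint ρ p)
    (hcyc : ¬ IsCyclic ρ.range) :
    IntervalDiff.EmbedsIntoC1Flow ρ := by
  let α := IntervalDiff.logDerivAction ρ hbv
  obtain ⟨τ, hcal⟩ := α.exists_forall_calibrates (fun p h0 h1 hfix => by
    by_contra! hℓ
    refine hpar p h0 h1 fun v => ⟨hfix v, ?_⟩
    have h : IntervalDiff.logD (ρ v) p = 0 := hℓ v
    rw [← IntervalDiff.exp_logD, h, Real.exp_zero])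
  have hτ : DenseRange τ := IntervalDiff.denseRange_of_not_isCyclic hcyc fun a ha =>
    Subtype.ext (OrderIso.ext (funext fun x => α.T_eq_of_eq_zero hcal ha x))
  obtain ⟨φ, hφ, h⟩ := IntervalDiff.exists_flow_extension ρ hτ fun ε hε => by
    have hε' : 0 < min 1 (ε / 4) := by positivity
    obtain ⟨δ, hδ, h⟩ := (Metric.nhds_basis_ball.comap τ).eventually_iff.1
      (α.eventually_abs_ℓ_lt hτ hcal hε')
    refine ⟨δ, hδ, fun a ha => ?_⟩
    have hℓ : ∀ x, |α.ℓ a x| ≤ min 1 (ε / 4) := fun x =>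
      (h (by simpa [Metric.mem_ball, Real.dist_eq] using ha) x).le
    have h1 := IntervalDiff.dist_one_le hε'.le
      (α.abs_T_sub_le a (min_le_left _ _) hℓ) hℓ
    refine h1.trans_lt ?_
    linarith [min_le_right 1 (ε / 4)]
  exact ⟨φ, hφ, τ, h⟩
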